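/- Theorem (reflective-oracle computable Nash equilibrium). Let $\mathcal A$ (actions) and $\mathcal E$ (percepts) be finite alphabets, $\Sigma=\mathcal A\sqcup\mathcal E$. For a probabilistic Turing machine $T$ with access to a (randomized) oracle $O$, let $\lambda_T^O(\alpha\mid x)$ be the probability that $T$ on input $x\in\Sigma^*$ halts with output $\alpha$. An oracle $O$ answers a query $(T,x,p,\alpha)$, with $T$ an oracle machine, $x\in\Sigma^*$, $p\in\mathbb Q\cap[0,1]$, $\alpha\in\mathcal A$, by $1$ with probability $O_\alpha(T,x,p)$ and by $0$ otherwise, independently at each call. It is reflective if for all $T,x$ there is $q:\mathcal A\to\mathbb R$ with $\sum_\alpha q_\alpha=1$ such that for every $\alpha$: $\lambda_T^O(\alpha\mid x)\le q_\alpha\le 1-\sum_{\beta\ne\alpha}\lambda_T^O(\beta\mid x)$, $O_\alpha(T,x,p)=1$ for $p<q_\alpha$, and $O_\alpha(T,x,p)=0$ for $p>q_\alpha$. A strategy $\pi:(\mathcal A\times\mathcal E)^*\to\Delta\mathcal A$ is reflective-oracle computable (w.r.t. $O$) if $\pi(a\mid h)=\lambda_T^O(a\mid h)$ for some $T$ and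 all $h,a$. Let $O$ be any reflective oracle. Let $\sigma:(\mathcal A^n\times\mathcal E^n)^*\times\mathcal A^n\to\Delta(\mathcal E^n)$ be an $n$-player game whose conditionals $\sigma(e\mid h a)$ are lower semicomputable in $(h,a,e)$. Let the reward $r:\mathcal E\to[0,1]$ be estimable (i.e. computable to any prescribed precision), and let $\gamma_t\ge 0$ be discounts with $\sum_t\gamma_t<\infty$ and estimable $\Gamma_t=\sum_{k\ge t}\gamma_k$. For strategies $\pi_1,\dots,\pi_n$ let $$\sigma_i(h)=\sum_{h'}\ \prod_{t}\Big(\sigma(e_t\mid h'_{<t}a_t)\prod_{j\ne i}\pi_j(a_t^j\mid h'^{\,j}_{<t})\Big)$$ be the subjective environment of player $i$, where the sum is over the joint histories $h'=a_1e_1a_2e_2\dots$ (of the same length as $h$) in which player $i$'s own history is $h$, and $\sigma_i(e\mid ha)=\sigma_i(hae)/\sigma_i(h)$. For $\sigma_i(h_{<t})>0$ let $$V_{\sigma_i}^{\pi}(h_{<t})=\frac1{\Gamma_t}\lim_{m\to\infty}\sum_{a_te_t\dots a_me_m}\Big(\sum_{k=t}^m\gamma_k r(e_k)\Big)\prod_{k=t}^m\pi(a_k\mid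 h_{<k})\,\sigma_i(e_k\mid h_{<k}a_k)$$ (read as $0$ if $\Gamma_t=0$), where $h_{<k}$ for $k>t$ denotes the history $h_{<t}$ continued by $a_te_t\dots a_{k-1}e_{k-1}$. Then there are strategies $\pi_1^*,\dots,\pi_n^*$, all reflective-oracle computable with respect to $O$, which are mutually optimal: for every player $i$, with $\sigma_i$ formed from $(\pi_j^*)_{j\ne i}$, for every strategy $\pi$ whatsoever and every history $h$ of player $i$ with $\sigma_i(h)>0$, $$V_{\sigma_i}^{\pi}(h)\le V_{\sigma_i}^{\pi_i^*}(h).$$ In particular (at the empty history) they form a Nash equilibrium. Moreover each player plays optimally also at the histories which his own strategy reaches with probability $0$; this is the sense in which the equilibrium is subgame perfect. -/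

import Mathlib

open Filter Topology

namespace ReflOracle

noncomputable section

/-! ### Estimable and lower semicomputable functions -/

/-- The rational number `(a - b) / (c + 1)` denoted by a triple of naturals; every rational is
denoted. Rational-valued computable functions are computable functions into such triples. -/
def ratOf (z : ℕ × ℕ × ℕ) : ℚ := ((z.1 : ℚ) - z.2.1) / (z.2.2 + 1)

/-- `f` can be approximated by a computable rational-valued `φ(x, k)` to every precision. -/
def Estimable {α : Type*} [Primcodable α] (f : α → ℝ) : Prop :=
  ∃ φ : α → ℕ → ℕ × ℕ × ℕ, Computable₂ φ ∧
    ∀ x k, |f x - (ratOf (φ x k) : ℝ)| < 1 / ((k : ℝ) + 1)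

/-- `f` is the limit of a computable rational-valued `φ(x, k)` which is increasing in `k`. -/
def LowerSemicomputable {α : Type*} [Primcodable α] (f : α → ℝ) : Prop :=
  ∃ φ : α → ℕ → ℕ × ℕ × ℕ, Computable₂ φ ∧
    (∀ x, Monotone fun k => ratOf (φ x k)) ∧
    ∀ x, Tendsto (fun k => (ratOf (φ x k) : ℝ)) atTop (𝓝 (f x))

/-! ### Probabilistic oracle machines

`A` is the alphabet of actions, `E` the alphabet of percepts, and strings are words over the
disjoint union `A ⊕ E`. Between two random events (reading a fresh random bit, receiving the answer
of the oracle) a probabilistic oracle machine computes deterministically. Its program is therefore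
a program in the ordinary sense (Mathlib's `Nat.Partrec.Code`), which from the input string and the
bits received so far (random bits and oracle answers, in the order in which they came) computes
what the machine does next. If this computation does not terminate, the machine does not halt. -/

/-- Programs of probabilistic oracle machines. -/
abbrev Machine := Nat.Partrec.Code

/-- What a machine may do next: read a random bit; ask the oracle the query `(T, y, p, α)`, with
the rational `p = min 1 (a / (b + 1))` written as the pair `(a, b)`; halt with an output string. -/
abbrev Action (A E : Type*) := Unit ⊕ (Machine × List (A ⊕ E) × (ℕ × ℕ) × A) ⊕ List (A ⊕ E)

/-- `O T x p α` is the probability that the answer to the query `(T, x, p, α)` is `1`. The answers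
to different calls (also of the same query) are independent. -/
abbrev Oracle (A E : Type*) :=
  Machine → List (A ⊕ E) → Set.Icc (0 : ℚ) 1 → A → Set.Icc (0 : ℝ) 1

/-- The rational number in `[0, 1]` written as the pair `(a, b)`; every one is written so. -/
def queryRat (z : ℕ × ℕ) : Set.Icc (0 : ℚ) 1 :=
  ⟨min 1 ((z.1 : ℚ) / (z.2 + 1)), le_min zero_le_one (by positivity), min_le_left _ _⟩

section Machines

variable {A E : Type*} [Primcodable A] [Primcodable E]

open Classical in
/-- What `T` does next on input `x` after it received the bits `bs`; `none` if the computation of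
this does not terminate (or produces nothing meaningful). -/
def Machine.next (T : Machine) (x : List (A ⊕ E)) (bs : List Bool) : Option (Action A E) :=
  (T.eval (Encodable.encode (x, bs))).toOption.bind Encodable.decode

open Classical in
/-- The probability that `T` with oracle `O` on input `x`, having received the bits `bs`, halts
with output `y` after fewer than `k` further random bits and oracle calls. -/
def haltProb (O : Oracle A E) (T : Machine) (x y : List (A ⊕ E)) : ℕ → List Bool → ℝ
  | 0, _ => 0
  | k + 1, bs =>
    match T.next (A := A) (E := E) x bs with
    | none => 0
    | some (Sum.inl _) =>
      1 / 2 * haltProb O T x y k (bs ++ [true]) + 1 / 2 * haltProb O T x y k (bs ++ [false])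
    | some (Sum.inr (Sum.inl (N, z, p, α))) =>
      (O N z (queryRat p) α : ℝ) * haltProb O T x y k (bs ++ [true]) +
        (1 - (O N z (queryRat p) α : ℝ)) * haltProb O T x y k (bs ++ [false])
    | some (Sum.inr (Sum.inr w)) => if w = y then 1 else 0

/-- `λ_T^O(α | x)`: the probability that `T` with oracle `O` on input `x` produces the symbol `α`
and nothing else. It is the supremum of an increasing sequence in `[0, 1]`. -/
def outProb (O : Oracle A E) (T : Machine) (x : List (A ⊕ E)) (α : A) : ℝ :=
  ⨆ k, haltProb O T x [Sum.inl α] k []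

theorem haltProb_mem_Icc (O : Oracle A E) (T : Machine) (x y : List (A ⊕ E)) (k : ℕ)
    (bs : List Bool) : haltProb O T x y k bs ∈ Set.Icc (0 : ℝ) 1 := by
  induction k generalizing bs with
  | zero => simp [haltProb]
  | succ k ih =>
    rw [haltProb]
    have h1 := ih (bs ++ [true])
    have h2 := ih (bs ++ [false])
    rw [Set.mem_Icc] at h1 h2 ⊢
    split
    · simp
    · constructor <;> linarith [h1.1, h1.2, h2.1, h2.2]
    · rename_i N z p α _
      have h3 := (O N z (queryRat p) α).2
      rw [Set.mem_Icc] at h3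
      constructor <;> nlinarith [h1.1, h1.2, h2.1, h2.2, h3.1, h3.2]
    · split_ifs <;> simp

theorem haltProb_mono (O : Oracle A E) (T : Machine) (x y : List (A ⊕ E)) (bs : List Bool) :
    Monotone fun k => haltProb O T x y k bs := by
  refine monotone_nat_of_le_succ fun k => ?_
  induction k generalizing bs with
  | zero => exact (haltProb_mem_Icc O T x y 1 bs).1
  | succ k ih =>
    rw [haltProb, haltProb]
    have h1 := ih (bs ++ [true])
    have h2 := ih (bs ++ [false])
    split
    · simp
    · linarith
    · rename_i N z p α _
      have h3 := (O N z (queryRat p) α).2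
      rw [Set.mem_Icc] at h3
      nlinarith [h3.1, h3.2]
    · simp

variable [Fintype A] [DecidableEq A]

/-- Reflective oracles: on every machine and every input the answers are consistent with a
completion `q` of the output probabilities of the machine to a probability distribution on `A`. -/
def Oracle.IsReflective (O : Oracle A E) : Prop :=
  ∀ (T : Machine) (x : List (A ⊕ E)), ∃ q : A → ℝ,
    ∑ α, q α = 1 ∧
    ∀ α, outProb O T x α ≤ q α ∧
      q α ≤ 1 - ∑ β ∈ Finset.univ.erase α, outProb O T x β ∧
      ∀ p : Set.Icc (0 : ℚ) 1,
        ((p : ℝ) < q α → (O T x p α : ℝ) = 1) ∧ (q α < (p : ℝ) → (O T x p α : ℝ) = 0)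

end Machines

/-! ### Games, strategies, subjective environments

Histories are lists in chronological order; `l.take t` is the history before the (zero-based) round
`t`. -/

section Games

variable {A E : Type*} {n : ℕ}

/-- The actions and percepts of all `n` players in one round. -/
abbrev Round (n : ℕ) (A E : Type*) := (Fin n → A) × (Fin n → E)

/-- A multi-player game: the distribution of the percept vector, given the history and the action
vector of the current round. -/
abbrev Game (n : ℕ) (A E : Type*) [Fintype E] :=
  List (Round n A E) → (Fin n → A) → stdSimplex ℝ (Fin n → E)

/-- A (behavior) strategy: the distribution of the next action, given the player's history. -/
abbrev Strategy (A E : Type*) [Fintype A] := List (A × E) → stdSimplex ℝ A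

/-- The part of a history which player `i` sees: his own actions and percepts. -/
def playerHistory (i : Fin n) (l : List (Round n A E)) : List (A × E) :=
  l.map fun x => (x.1 i, x.2 i)

/-- The string `a₁e₁a₂e₂…` which represents a player's history on the input tape. -/
def historyString (h : List (A × E)) : List (A ⊕ E) :=
  h.flatMap fun x => [Sum.inl x.1, Sum.inr x.2]

/-- Strategies computed by a probabilistic machine with access to the oracle `O`. -/
def Strategy.IsOracleComputable [Fintype A] [Primcodable A] [Primcodable E]
    (O : Oracle A E) (π : Strategy A E) : Prop :=
  ∃ T : Machine, ∀ (h : List (A × E)) (a : A), π h a = outProb O T (historyString h) a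

variable [Fintype A] [Fintype E]

/-- The history distribution `σ^π` of the strategies `π` interacting in the game `σ`. -/
def historyProb (σ : Game n A E) (π : Fin n → Strategy A E) (l : List (Round n A E)) : ℝ :=
  ∏ t : Fin l.length,
    (∏ j, π j (playerHistory j (l.take t)) (l[t].1 j)) * σ (l.take t) l[t].1 l[t].2

/-- The probability of a history in game `σ` when player `i` plays his actions in it for sure and
the others follow `π`. -/
def contextProb (σ : Game n A E) (π : Fin n → Strategy A E) (i : Fin n)
    (l : List (Round n A E)) : ℝ :=
  ∏ t : Fin l.length,
    (∏ j ∈ Finset.univ.erase i, π j (playerHistory j (l.take t)) (l[t].1 j)) *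
      σ (l.take t) l[t].1 l[t].2

theorem sum_ofFn_succ (m : ℕ) (F : List (Round n A E) → ℝ) :
    ∑ g : Fin (m + 1) → Round n A E, F (List.ofFn g) =
      ∑ g : Fin m → Round n A E, ∑ x, F (List.ofFn g ++ [x]) := by
  rw [← (Fin.snocEquiv fun _ : Fin (m + 1) => Round n A E).sum_comp, Fintype.sum_prod_type_right]
  refine Finset.sum_congr rfl fun g _ => Finset.sum_congr rfl fun x _ => ?_
  rw [List.ofFn_succ', List.concat_eq_append]
  simp [Fin.snocEquiv]

theorem contextProb_append (σ : Game n A E) (π : Fin n → Strategy A E) (i : Fin n)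
    (l : List (Round n A E)) (x : Round n A E) :
    contextProb σ π i (l ++ [x]) = contextProb σ π i l *
      ((∏ j ∈ Finset.univ.erase i, π j (playerHistory j l) (x.1 j)) * σ l x.1 x.2) := by
  have hlen : (l ++ [x]).length = l.length + 1 := by simp
  rw [contextProb, contextProb, ← (finCongr hlen.symm).prod_comp, Fin.prod_univ_castSucc]
  congr 1
  · refine Finset.prod_congr rfl fun t _ => ?_
    have ht := t.2
    simp [List.take_append_of_le_length ht.le]
  · simp

variable [DecidableEq A]

theorem sum_round (σ : Game n A E) (π : Fin n → Strategy A E) (i : Fin n)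
    (l : List (Round n A E)) (a : A) :
    ∑ x : Round n A E, (if x.1 i = a then
      (∏ j ∈ Finset.univ.erase i, π j (playerHistory j l) (x.1 j)) * σ l x.1 x.2 else 0) = 1 := by
  rw [Fintype.sum_prod_type]
  have h1 : ∀ b : Fin n → A, ∑ y : Fin n → E, (if b i = a then
      (∏ j ∈ Finset.univ.erase i, π j (playerHistory j l) (b j)) * σ l b y else 0) =
      ∏ j, (if j = i then (if b j = a then 1 else 0) else π j (playerHistory j l) (b j)) := by
    intro b
    rw [← Finset.mul_prod_erase Finset.univ _ (Finset.mem_univ i), if_pos rfl]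
    have h2 : ∀ j ∈ Finset.univ.erase i, (if j = i then (if b j = a then (1 : ℝ) else 0)
        else π j (playerHistory j l) (b j)) = π j (playerHistory j l) (b j) := by
      intro j hj
      simp [Finset.ne_of_mem_erase hj]
    rw [Finset.prod_congr rfl h2]
    split_ifs
    · rw [← Finset.mul_sum]
      have h3 : ∑ y, σ l b y = 1 := (σ l b).2.2
      simp [h3]
    · simp
  simp only [h1]
  rw [← Fintype.prod_sum (f := fun j c => if j = i then (if c = a then (1 : ℝ) else 0)
    else π j (playerHistory j l) c)]
  refine Finset.prod_eq_one fun j _ => ?_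
  split_ifs
  · simp
  · exact (π j (playerHistory j l)).2.2

variable [DecidableEq E]

/-- The history distribution `σ_i^π` for player `i`: the marginal of `σ^π`. -/
def marginalProb (σ : Game n A E) (π : Fin n → Strategy A E) (i : Fin n) (h : List (A × E)) : ℝ :=
  ∑ g : Fin h.length → Round n A E,
    if playerHistory i (List.ofFn g) = h then historyProb σ π (List.ofFn g) else 0

/-- The subjective environment of player `i` as an action-contextual measure: the probability
`σ_i(e₁…eₜ || a₁…aₜ)` of his percepts given his actions in `h`. It does not depend on `π i`. -/
def subjectiveEnv (σ : Game n A E) (π : Fin n → Strategy A E) (i : Fin n)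
    (h : List (A × E)) : ℝ :=
  ∑ g : Fin h.length → Round n A E,
    if playerHistory i (List.ofFn g) = h then contextProb σ π i (List.ofFn g) else 0

/-- The history distribution of player `i` is the product of his own action probabilities and of
his subjective environment. -/
theorem marginalProb_eq (σ : Game n A E) (π : Fin n → Strategy A E) (i : Fin n)
    (h : List (A × E)) :
    marginalProb σ π i h =
      (∏ t : Fin h.length, π i (h.take t) h[t].1) * subjectiveEnv σ π i h := by
  rw [marginalProb, subjectiveEnv, Finset.mul_sum]
  refine Finset.sum_congr rfl fun g _ => ?_
  split_ifs with hg
  · generalize List.ofFn g = l at hg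
    subst hg
    have hlen : (playerHistory i l).length = l.length := by simp [playerHistory]
    have hp : (∏ t : Fin (playerHistory i l).length,
        π i ((playerHistory i l).take t) (playerHistory i l)[t].1) =
        ∏ t : Fin l.length, π i (playerHistory i (l.take t)) (l[t].1 i) := by
      refine Fintype.prod_equiv (finCongr hlen) _ _ fun t => ?_
      have ht : (playerHistory i l)[t].1 = l[finCongr hlen t].1 i :=
        congrArg Prod.fst (List.getElem_map (fun x : Round n A E => (x.1 i, x.2 i)))
      have hl : (playerHistory i l).take t = playerHistory i (l.take (finCongr hlen t)) :=
        List.map_take.symm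
      rw [ht, hl]
    rw [hp, historyProb, contextProb, ← Finset.prod_mul_distrib]
    refine Finset.prod_congr rfl fun t _ => ?_
    rw [← Finset.mul_prod_erase Finset.univ _ (Finset.mem_univ i), mul_assoc]
  · simp

/-- The conditional probability `ν(e | h a)` of an action-contextual measure `ν`. -/
def envCond (ν : List (A × E) → ℝ) (h : List (A × E)) (a : A) (e : E) : ℝ :=
  ν (h ++ [(a, e)]) / ν h

/-- A subjective environment is a chronological action-contextual measure. -/
theorem sum_subjectiveEnv (σ : Game n A E) (π : Fin n → Strategy A E) (i : Fin n)
    (h : List (A × E)) (a : A) :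
    ∑ e, subjectiveEnv σ π i (h ++ [(a, e)]) = subjectiveEnv σ π i h := by
  have key : ∀ e, subjectiveEnv σ π i (h ++ [(a, e)]) =
      ∑ g : Fin h.length → Round n A E, ∑ x : Round n A E,
        if playerHistory i (List.ofFn g ++ [x]) = h ++ [(a, e)] then
          contextProb σ π i (List.ofFn g ++ [x]) else 0 := by
    intro e
    have hlen : (h ++ [(a, e)]).length = h.length + 1 := by simp
    rw [subjectiveEnv, hlen, sum_ofFn_succ h.length
      (fun l => if playerHistory i l = h ++ [(a, e)] then contextProb σ π i l else 0)]
  simp only [key]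
  rw [Finset.sum_comm, subjectiveEnv]
  refine Finset.sum_congr rfl fun g _ => ?_
  generalize List.ofFn g = l
  rw [Finset.sum_comm]
  have h1 : ∀ x : Round n A E, (∑ e, if playerHistory i (l ++ [x]) = h ++ [(a, e)] then
      contextProb σ π i (l ++ [x]) else 0) =
      (if playerHistory i l = h then contextProb σ π i l else 0) * (if x.1 i = a then
        (∏ j ∈ Finset.univ.erase i, π j (playerHistory j l) (x.1 j)) * σ l x.1 x.2 else 0) := by
    intro x
    have h2 : ∀ e, (playerHistory i (l ++ [x]) = h ++ [(a, e)]) ↔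
        (playerHistory i l = h ∧ x.1 i = a) ∧ x.2 i = e := by
      intro e
      have : playerHistory i (l ++ [x]) = playerHistory i l ++ [(x.1 i, x.2 i)] := by
        simp [playerHistory]
      rw [this, ← List.concat_eq_append, ← List.concat_eq_append, List.concat_inj]
      simp [and_assoc]
    simp only [h2, contextProb_append]
    by_cases p : playerHistory i l = h <;> by_cases q : x.1 i = a <;> simp [p, q]
  simp only [h1]
  rw [← Finset.mul_sum, sum_round, mul_one]

/-- The conditional probabilities of a subjective environment are probability distributions on the
percepts, at every history which it gives positive probability. -/
theorem sum_envCond (σ : Game n A E) (π : Fin n → Strategy A E) (i : Fin n)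
    (h : List (A × E)) (a : A) (hh : 0 < subjectiveEnv σ π i h) :
    ∑ e, envCond (subjectiveEnv σ π i) h a e = 1 := by
  simp only [envCond]
  rw [← Finset.sum_div, sum_subjectiveEnv, div_self hh.ne']

/-! ### Value and optimality -/

/-- The discount normalization factor `Γ_t = ∑_{k ≥ t} γ_k` (rounds are numbered from `0`). -/
def discountNorm (γ : ℕ → ℝ) (t : ℕ) : ℝ := ∑' k, γ (t + k)

/-- The expected discounted reward sum of strategy `π` in environment `ν` over the `m` rounds which
follow the history `h`. -/
def finiteValue (r : E → ℝ) (γ : ℕ → ℝ) (ν : List (A × E) → ℝ) (π : Strategy A E)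
    (h : List (A × E)) (m : ℕ) : ℝ :=
  ∑ g : Fin m → A × E,
    (∑ k : Fin m, γ (h.length + k) * r (g k).2) *
      ∏ k : Fin m, π (h ++ (List.ofFn g).take k) (g k).1 *
        envCond ν (h ++ (List.ofFn g).take k) (g k).1 (g k).2

/-- The value function `V_ν^π(h)`. -/
def value (r : E → ℝ) (γ : ℕ → ℝ) (ν : List (A × E) → ℝ) (π : Strategy A E)
    (h : List (A × E)) : ℝ :=
  1 / discountNorm γ h.length * limUnder atTop (finiteValue r γ ν π h)

/-- `π` is an optimal strategy for the environment `ν`: it maximizes the value, among all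
strategies, at every history which `ν` gives positive probability, whether or not `π` itself reaches
this history with positive probability. -/
def IsOptimal (r : E → ℝ) (γ : ℕ → ℝ) (ν : List (A × E) → ℝ) (π : Strategy A E) : Prop :=
  ∀ h, 0 < ν h → ∀ π' : Strategy A E, value r γ ν π' h ≤ value r γ ν π h

end Games

end

end ReflOracle

/-!
The strategies are given by machines which know each other's programs, by Kleene's recursion theorem
(`exists_code_eval_curry`). There are two kinds of them.

* The machine of player `i` finds his next action by a tournament among all actions. Each duel of
  two actions `a`, `b` is decided by one oracle call, about the output of the machine below at the
  threshold `1/2`. It makes a bounded number of calls and therefore halts surely, whatever the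
  oracle answers. So the players' strategies `π` are well defined, and the oracle, being reflective,
  compares their probabilities correctly to all rational numbers (`Oracle.IsReflective.answer`).
* The machine of the duel asks the oracle, one after the other, all questions of the form "is
  `π j h α` above `p`?", until the answers received so far prove that one of the two actions is
  better for player `i`; it outputs this action. If one of them is better, it halts surely
  (`haltProb_search`), and the duel has the right result. If both are equally good, it runs forever,
  and any answer of the oracle is right. Thus it does no harm that ties are undecidable.

The value which the actions are compared by is the value `actionValue` for player `i` of taking the
action and then following the very strategy `π i` under construction, multiplied by the probability
of the history. This is a countable sum of products of nonnegative numbers, each approximable from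
below; no maximum over strategies occurs in it, and no division by a probability which may vanish.
Such sums can be approximated from below using the answers (`LowerApprox` and its closure
properties). Upper bounds come from the complementary reward `1 - r`, from the probabilities of the
other percept sequences, and from the estimable `Γ` (`lowerApprox_actionValue_sub`).

Finally, a strategy whose actions always maximize its own action values is optimal: by induction on
`m`, what any other strategy gains in the next `m` rounds is at most the future value of `π i`
(`sum_layerValue_le_futureValue`). It remains to let `m` tend to infinity.
-/

namespace ReflOracle

noncomputable section

/-! ### Rational arithmetic on codes -/

/-- The nonnegative rational number `a / (b + 1)` denoted by a pair of naturals. -/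
def frac (z : ℕ × ℕ) : ℝ := z.1 / ((z.2 : ℝ) + 1)

/-- Addition of fractions. -/
def addFrac (z w : ℕ × ℕ) : ℕ × ℕ :=
  (z.1 * (w.2 + 1) + w.1 * (z.2 + 1), z.2 * w.2 + z.2 + w.2)

/-- Multiplication of fractions. -/
def mulFrac (z w : ℕ × ℕ) : ℕ × ℕ := (z.1 * w.1, z.2 * w.2 + z.2 + w.2)

/-- The larger one of two fractions. -/
def maxFrac (z w : ℕ × ℕ) : ℕ × ℕ := if z.1 * (w.2 + 1) ≤ w.1 * (z.2 + 1) then w else z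

/-- Subtraction of rational numbers coded as triples. -/
def subRat (z w : ℕ × ℕ × ℕ) : ℕ × ℕ × ℕ :=
  (z.1 * (w.2.2 + 1) + w.2.1 * (z.2.2 + 1), z.2.1 * (w.2.2 + 1) + w.1 * (z.2.2 + 1),
    z.2.2 * w.2.2 + z.2.2 + w.2.2)

/-- The positive part of a rational number coded as a triple; the truncated subtraction of naturals
is what cuts off at zero. -/
def posFrac (z : ℕ × ℕ × ℕ) : ℕ × ℕ := (z.1 - z.2.1, z.2.2)

/-- `op (… (op (op z (g 0)) (g 1)) …) (g (N - 1))`. -/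
def foldUpTo {σ : Type*} (op : σ → σ → σ) (z : σ) (g : ℕ → σ) (N : ℕ) : σ :=
  Nat.rec z (fun k acc => op acc (g k)) N

theorem frac_nonneg (z : ℕ × ℕ) : 0 ≤ frac z := by unfold frac; positivity

@[simp] theorem frac_zero : frac (0, 0) = 0 := by simp [frac]

@[simp] theorem frac_nat (c : ℕ) : frac (c, 0) = c := by simp [frac]

theorem frac_addFrac (z w : ℕ × ℕ) : frac (addFrac z w) = frac z + frac w := by
  have h1 : ((z.2 : ℝ) + 1) ≠ 0 := by positivity
  have h2 : ((w.2 : ℝ) + 1) ≠ 0 := by positivity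
  have h3 : ((z.2 : ℝ) * w.2 + z.2 + w.2 + 1) ≠ 0 := by positivity
  simp only [frac, addFrac]
  push_cast
  field_simp
  ring

theorem frac_mulFrac (z w : ℕ × ℕ) : frac (mulFrac z w) = frac z * frac w := by
  have h1 : ((z.2 : ℝ) + 1) ≠ 0 := by positivity
  have h2 : ((w.2 : ℝ) + 1) ≠ 0 := by positivity
  have h3 : ((z.2 : ℝ) * w.2 + z.2 + w.2 + 1) ≠ 0 := by positivity
  simp only [frac, mulFrac]
  push_cast
  field_simp
  ring

theorem frac_maxFrac (z w : ℕ × ℕ) : frac (maxFrac z w) = max (frac z) (frac w) := by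
  have key : frac z ≤ frac w ↔ z.1 * (w.2 + 1) ≤ w.1 * (z.2 + 1) := by
    rw [frac, frac, div_le_div_iff₀ (by positivity) (by positivity)]
    exact_mod_cast Iff.rfl
  rw [maxFrac]
  split_ifs with h
  · rw [max_eq_right (key.2 h)]
  · rw [max_eq_left (le_of_not_ge fun h' => h (key.1 h'))]

theorem ratOf_subRat (z w : ℕ × ℕ × ℕ) : ratOf (subRat z w) = ratOf z - ratOf w := by
  have h1 : ((z.2.2 : ℚ) + 1) ≠ 0 := by positivity
  have h2 : ((w.2.2 : ℚ) + 1) ≠ 0 := by positivity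
  have h3 : ((z.2.2 : ℚ) * w.2.2 + z.2.2 + w.2.2 + 1) ≠ 0 := by positivity
  simp only [ratOf, subRat]
  push_cast
  field_simp
  ring

theorem frac_posFrac (z : ℕ × ℕ × ℕ) : frac (posFrac z) = max 0 (ratOf z : ℝ) := by
  simp only [frac, posFrac, ratOf]
  push_cast
  rcases le_total z.1 z.2.1 with h | h
  · have h' : (z.1 : ℝ) ≤ z.2.1 := by exact_mod_cast h
    rw [Nat.sub_eq_zero_of_le h, max_eq_left]
    · simp
    · exact div_nonpos_of_nonpos_of_nonneg (by linarith) (by positivity)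
  · have h' : (z.2.1 : ℝ) ≤ z.1 := by exact_mod_cast h
    rw [Nat.cast_sub h, max_eq_right]
    exact div_nonneg (by linarith) (by positivity)

theorem frac_foldUpTo_add (g : ℕ → ℕ × ℕ) (N : ℕ) :
    frac (foldUpTo addFrac (0, 0) g N) = ∑ k ∈ Finset.range N, frac (g k) := by
  induction N with
  | zero => simp [foldUpTo]
  | succ N ih => rw [Finset.sum_range_succ, ← ih, ← frac_addFrac]; rfl

theorem frac_foldUpTo_mul (g : ℕ → ℕ × ℕ) (N : ℕ) :
    frac (foldUpTo mulFrac (1, 0) g N) = ∏ k ∈ Finset.range N, frac (g k) := by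
  induction N with
  | zero => simp [foldUpTo]
  | succ N ih => rw [Finset.prod_range_succ, ← ih, ← frac_mulFrac]; rfl

theorem le_frac_foldUpTo_max (g : ℕ → ℕ × ℕ) {N k : ℕ} (hk : k < N) :
    frac (g k) ≤ frac (foldUpTo maxFrac (0, 0) g N) := by
  induction N with
  | zero => omega
  | succ N ih =>
    have : foldUpTo maxFrac (0, 0) g (N + 1) =
        maxFrac (foldUpTo maxFrac (0, 0) g N) (g N) := rfl
    rw [this, frac_maxFrac]
    rcases Nat.lt_succ_iff_lt_or_eq.1 hk with h | rfl
    · exact (ih h).trans (le_max_left _ _)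
    · exact le_max_right _ _

theorem frac_foldUpTo_max_le (g : ℕ → ℕ × ℕ) (N : ℕ) {B : ℝ} (hB : 0 ≤ B)
    (h : ∀ k, frac (g k) ≤ B) : frac (foldUpTo maxFrac (0, 0) g N) ≤ B := by
  induction N with
  | zero => simpa [foldUpTo] using hB
  | succ N ih =>
    have : foldUpTo maxFrac (0, 0) g (N + 1) =
        maxFrac (foldUpTo maxFrac (0, 0) g N) (g N) := rfl
    rw [this, frac_maxFrac]
    exact max_le ih (h N)

section
open Primrec

theorem primrec_addFrac : Primrec₂ addFrac := by
  have z1 : Primrec fun p : (ℕ × ℕ) × (ℕ × ℕ) => p.1.1 := fst.comp fst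
  have z2 : Primrec fun p : (ℕ × ℕ) × (ℕ × ℕ) => p.1.2 := snd.comp fst
  have w1 : Primrec fun p : (ℕ × ℕ) × (ℕ × ℕ) => p.2.1 := fst.comp snd
  have w2 : Primrec fun p : (ℕ × ℕ) × (ℕ × ℕ) => p.2.2 := snd.comp snd
  exact Primrec.pair
    (nat_add.comp (nat_mul.comp z1 (succ.comp w2)) (nat_mul.comp w1 (succ.comp z2)))
    (nat_add.comp (nat_add.comp (nat_mul.comp z2 w2) z2) w2)

theorem primrec_mulFrac : Primrec₂ mulFrac := by
  have z1 : Primrec fun p : (ℕ × ℕ) × (ℕ × ℕ) => p.1.1 := fst.comp fst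
  have z2 : Primrec fun p : (ℕ × ℕ) × (ℕ × ℕ) => p.1.2 := snd.comp fst
  have w1 : Primrec fun p : (ℕ × ℕ) × (ℕ × ℕ) => p.2.1 := fst.comp snd
  have w2 : Primrec fun p : (ℕ × ℕ) × (ℕ × ℕ) => p.2.2 := snd.comp snd
  exact Primrec.pair (nat_mul.comp z1 w1)
    (nat_add.comp (nat_add.comp (nat_mul.comp z2 w2) z2) w2)

theorem primrec_maxFrac : Primrec₂ maxFrac := by
  have z1 : Primrec fun p : (ℕ × ℕ) × (ℕ × ℕ) => p.1.1 := fst.comp fst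
  have z2 : Primrec fun p : (ℕ × ℕ) × (ℕ × ℕ) => p.1.2 := snd.comp fst
  have w1 : Primrec fun p : (ℕ × ℕ) × (ℕ × ℕ) => p.2.1 := fst.comp snd
  have w2 : Primrec fun p : (ℕ × ℕ) × (ℕ × ℕ) => p.2.2 := snd.comp snd
  exact Primrec.ite (nat_le.comp (nat_mul.comp z1 (succ.comp w2)) (nat_mul.comp w1 (succ.comp z2)))
    snd fst

theorem primrec_subRat : Primrec₂ subRat := by
  have z1 : Primrec fun p : (ℕ × ℕ × ℕ) × (ℕ × ℕ × ℕ) => p.1.1 := fst.comp fst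
  have z2 : Primrec fun p : (ℕ × ℕ × ℕ) × (ℕ × ℕ × ℕ) => p.1.2.1 := fst.comp (snd.comp fst)
  have z3 : Primrec fun p : (ℕ × ℕ × ℕ) × (ℕ × ℕ × ℕ) => p.1.2.2 := snd.comp (snd.comp fst)
  have w1 : Primrec fun p : (ℕ × ℕ × ℕ) × (ℕ × ℕ × ℕ) => p.2.1 := fst.comp snd
  have w2 : Primrec fun p : (ℕ × ℕ × ℕ) × (ℕ × ℕ × ℕ) => p.2.2.1 := fst.comp (snd.comp snd)
  have w3 : Primrec fun p : (ℕ × ℕ × ℕ) × (ℕ × ℕ × ℕ) => p.2.2.2 := snd.comp (snd.comp snd)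
  exact Primrec.pair
    (nat_add.comp (nat_mul.comp z1 (succ.comp w3)) (nat_mul.comp w2 (succ.comp z3)))
    (Primrec.pair
      (nat_add.comp (nat_mul.comp z2 (succ.comp w3)) (nat_mul.comp w1 (succ.comp z3)))
      (nat_add.comp (nat_add.comp (nat_mul.comp z3 w3) z3) w3))

theorem primrec_posFrac : Primrec posFrac :=
  Primrec.pair (nat_sub.comp fst (fst.comp snd)) (snd.comp snd)

end

theorem computable_foldUpTo {α σ : Type*} [Primcodable α] [Primcodable σ] {op : σ → σ → σ}
    (hop : Computable₂ op) (z : σ) {g : α → ℕ → σ} (hg : Computable₂ g) {N : α → ℕ}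
    (hN : Computable N) : Computable fun x => foldUpTo op z (g x) (N x) := by
  refine Computable.nat_rec hN (Computable.const z)
    (h := fun x p => op p.2 (g x p.1)) ?_
  exact hop.comp (Computable.snd.comp Computable.snd)
    (hg.comp Computable.fst (Computable.fst.comp Computable.snd))

/-! ### Estimable functions -/

section Estimable

variable {α β : Type*} [Primcodable α] [Primcodable β]

theorem Estimable.comp {f : α → ℝ} (hf : Estimable f) {g : β → α} (hg : Computable g) :
    Estimable fun x => f (g x) := by
  obtain ⟨φ, hφ, h⟩ := hf
  exact ⟨fun x k => φ (g x) k, hφ.comp (hg.comp Computable.fst) Computable.snd,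
    fun x k => h (g x) k⟩

theorem estimable_const (c : ℕ) : Estimable fun _ : α => (c : ℝ) := by
  refine ⟨fun _ _ => (c, 0, 0), Computable.const _, fun x k => ?_⟩
  simp only [ratOf]
  push_cast
  simp
  positivity

theorem Estimable.sub {f g : α → ℝ} (hf : Estimable f) (hg : Estimable g) :
    Estimable fun x => f x - g x := by
  obtain ⟨φ, hφ, h⟩ := hf
  obtain ⟨ψ, hψ, h'⟩ := hg
  have hk : Computable fun p : α × ℕ => 2 * p.2 + 1 :=
    (Primrec.nat_double_succ.comp Primrec.snd).to_comp
  refine ⟨fun x k => subRat (φ x (2 * k + 1)) (ψ x (2 * k + 1)),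
    primrec_subRat.to_comp.comp (hφ.comp Computable.fst hk) (hψ.comp Computable.fst hk),
    fun x k => ?_⟩
  have h1 := abs_lt.1 (h x (2 * k + 1))
  have h2 := abs_lt.1 (h' x (2 * k + 1))
  have h3 : (1 : ℝ) / ((k : ℝ) + 1) = 1 / (((2 * k + 1 : ℕ) : ℝ) + 1) +
      1 / (((2 * k + 1 : ℕ) : ℝ) + 1) := by
    push_cast
    field_simp
    ring
  rw [ratOf_subRat, abs_lt, h3]
  push_cast at h1 h2 ⊢
  constructor <;> linarith [h1.1, h1.2, h2.1, h2.2]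

end Estimable

/-! ### Lower approximation from the answers to a list of questions -/

section LowerApprox

variable {A E : Type*} [Primcodable A] [Primcodable E] [Fintype A] {n : ℕ}

/-- The question whether the probability with which a player chooses an action at a history exceeds
a rational number (written as a pair). Questions are numbered by their codes. -/
abbrev Question (n : ℕ) (A E : Type*) := Fin n × List (A × E) × (ℕ × ℕ) × A

/-- `bs` consists of correct answers to the first questions; at equality both answers are
correct. Positions which are not the code of a question may hold any bit. -/
def CorrectAnswers (π : Fin n → Strategy A E) (bs : List Bool) : Prop :=
  ∀ (s : ℕ) (q : Question n A E) (b : Bool), Encodable.decode s = some q → bs[s]? = some b →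
    (b = true → ((queryRat q.2.2.1 : ℚ) : ℝ) ≤ π q.1 q.2.1 q.2.2.2) ∧
    (b = false → π q.1 q.2.1 q.2.2.2 ≤ ((queryRat q.2.2.1 : ℚ) : ℝ))

/-- Ever longer lists of correct answers. -/
def answers (π : Fin n → Strategy A E) : Filter (List Bool) :=
  comap List.length atTop ⊓ 𝓟 {bs | CorrectAnswers π bs}

theorem tendsto_length_answers (π : Fin n → Strategy A E) :
    Tendsto List.length (answers π) atTop :=
  tendsto_comap.mono_left inf_le_left

theorem eventually_correctAnswers (π : Fin n → Strategy A E) :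
    ∀ᶠ bs in answers π, CorrectAnswers π bs :=
  eventually_inf_principal.2 (Eventually.of_forall fun _ h => h)

theorem eventually_answers_iff (π : Fin n → Strategy A E) {p : List Bool → Prop} :
    (∀ᶠ bs in answers π, p bs) ↔ ∃ s, ∀ bs, s ≤ bs.length → CorrectAnswers π bs → p bs := by
  rw [answers, eventually_inf_principal, eventually_comap, eventually_atTop]
  constructor
  · rintro ⟨s, hs⟩
    exact ⟨s, fun bs h1 h2 => hs _ h1 bs rfl h2⟩
  · rintro ⟨s, hs⟩
    exact ⟨s, fun m hm bs h1 h2 => hs bs (h1 ▸ hm) h2⟩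

/-- A quantity which depends on the strategies of the players is lower approximable if from the
answers to the first questions about the strategies a rational lower bound can be computed, which
converges to the quantity as more answers are known. The computation does not depend on the
strategies. -/
def LowerApprox {α : Type*} [Primcodable α] (f : (Fin n → Strategy A E) → α → ℝ) : Prop :=
  ∃ φ : α → List Bool → ℕ × ℕ, Computable₂ φ ∧ ∀ π x,
    (∀ bs, CorrectAnswers π bs → frac (φ x bs) ≤ f π x) ∧
    Tendsto (fun bs => frac (φ x bs)) (answers π) (𝓝 (f π x))

theorem correctAnswers_nil (π : Fin n → Strategy A E) : CorrectAnswers π [] := by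
  intro s q b _ h
  simp at h

namespace LowerApprox

variable {α β : Type*} [Primcodable α] [Primcodable β]
variable {f g : (Fin n → Strategy A E) → α → ℝ}

theorem nonneg (hf : LowerApprox f) (π : Fin n → Strategy A E) (x : α) : 0 ≤ f π x := by
  obtain ⟨φ, -, h⟩ := hf
  exact (frac_nonneg _).trans ((h π x).1 [] (correctAnswers_nil π))

theorem congr (hf : LowerApprox f) (h : ∀ π x, f π x = g π x) : LowerApprox g := by
  have : f = g := funext fun π => funext fun x => h π x
  exact this ▸ hf

theorem comp (hf : LowerApprox f) {u : β → α} (hu : Computable u) :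
    LowerApprox fun π x => f π (u x) := by
  obtain ⟨φ, hφ, h⟩ := hf
  exact ⟨fun x bs => φ (u x) bs, hφ.comp (hu.comp Computable.fst) Computable.snd,
    fun π x => h π (u x)⟩

theorem natCast (c : ℕ) : LowerApprox fun (_ : Fin n → Strategy A E) (_ : α) => (c : ℝ) :=
  ⟨fun _ _ => (c, 0), Computable.const _, fun π x => by simp [tendsto_const_nhds]⟩

theorem add (hf : LowerApprox f) (hg : LowerApprox g) : LowerApprox fun π x => f π x + g π x := by
  obtain ⟨φ, hφ, h⟩ := hf
  obtain ⟨ψ, hψ, h'⟩ := hg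
  refine ⟨fun x bs => addFrac (φ x bs) (ψ x bs), primrec_addFrac.to_comp.comp hφ hψ,
    fun π x => ?_⟩
  simp only [frac_addFrac]
  exact ⟨fun bs hb => add_le_add ((h π x).1 bs hb) ((h' π x).1 bs hb), (h π x).2.add (h' π x).2⟩

theorem mul (hf : LowerApprox f) (hg : LowerApprox g) : LowerApprox fun π x => f π x * g π x := by
  have hf' := hf.nonneg
  obtain ⟨φ, hφ, h⟩ := hf
  obtain ⟨ψ, hψ, h'⟩ := hg
  refine ⟨fun x bs => mulFrac (φ x bs) (ψ x bs), primrec_mulFrac.to_comp.comp hφ hψ,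
    fun π x => ?_⟩
  simp only [frac_mulFrac]
  exact ⟨fun bs hb => mul_le_mul ((h π x).1 bs hb) ((h' π x).1 bs hb) (frac_nonneg _) (hf' π x),
    (h π x).2.mul (h' π x).2⟩

theorem finset_sum {ι : Type*} (s : Finset ι) {f : ι → (Fin n → Strategy A E) → α → ℝ}
    (hf : ∀ i ∈ s, LowerApprox (f i)) : LowerApprox fun π x => ∑ i ∈ s, f i π x := by
  classical
  induction s using Finset.induction_on with
  | empty => simpa using natCast (n := n) (A := A) (E := E) (α := α) 0
  | insert i s hi ih =>
    simp only [Finset.sum_insert hi]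
    exact (hf i (Finset.mem_insert_self _ _)).add
      (ih fun j hj => hf j (Finset.mem_insert_of_mem hj))

theorem finset_prod {ι : Type*} (s : Finset ι) {f : ι → (Fin n → Strategy A E) → α → ℝ}
    (hf : ∀ i ∈ s, LowerApprox (f i)) : LowerApprox fun π x => ∏ i ∈ s, f i π x := by
  classical
  induction s using Finset.induction_on with
  | empty => simpa using natCast (n := n) (A := A) (E := E) (α := α) 1
  | insert i s hi ih =>
    simp only [Finset.prod_insert hi]
    exact (hf i (Finset.mem_insert_self _ _)).mul
      (ih fun j hj => hf j (Finset.mem_insert_of_mem hj))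

theorem range_sum {f : (Fin n → Strategy A E) → α × ℕ → ℝ} (hf : LowerApprox f) {N : α → ℕ}
    (hN : Computable N) : LowerApprox fun π x => ∑ k ∈ Finset.range (N x), f π (x, k) := by
  obtain ⟨φ, hφ, h⟩ := hf
  refine ⟨fun x bs => foldUpTo addFrac (0, 0) (fun k => φ (x, k) bs) (N x),
    computable_foldUpTo primrec_addFrac.to_comp _ (g := fun (p : α × List Bool) k => φ (p.1, k) p.2)
      (hφ.comp ((Computable.fst.comp Computable.fst).pair Computable.snd)
        (Computable.snd.comp Computable.fst)) (hN.comp Computable.fst), fun π x => ?_⟩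
  simp only [frac_foldUpTo_add]
  exact ⟨fun bs hb => Finset.sum_le_sum fun k _ => (h π (x, k)).1 bs hb,
    tendsto_finsetSum _ fun k _ => (h π (x, k)).2⟩

theorem range_prod {f : (Fin n → Strategy A E) → α × ℕ → ℝ} (hf : LowerApprox f) {N : α → ℕ}
    (hN : Computable N) : LowerApprox fun π x => ∏ k ∈ Finset.range (N x), f π (x, k) := by
  obtain ⟨φ, hφ, h⟩ := hf
  refine ⟨fun x bs => foldUpTo mulFrac (1, 0) (fun k => φ (x, k) bs) (N x),
    computable_foldUpTo primrec_mulFrac.to_comp _ (g := fun (p : α × List Bool) k => φ (p.1, k) p.2)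
      (hφ.comp ((Computable.fst.comp Computable.fst).pair Computable.snd)
        (Computable.snd.comp Computable.fst)) (hN.comp Computable.fst), fun π x => ?_⟩
  simp only [frac_foldUpTo_mul]
  exact ⟨fun bs hb => Finset.prod_le_prod (fun k _ => frac_nonneg _)
      fun k _ => (h π (x, k)).1 bs hb,
    tendsto_finsetProd _ fun k _ => (h π (x, k)).2⟩

theorem option_elim {f : (Fin n → Strategy A E) → α × β → ℝ} (hf : LowerApprox f)
    {o : α → Option β} (ho : Computable o) (c : ℕ) :
    LowerApprox fun π x => (o x).elim (c : ℝ) fun y => f π (x, y) := by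
  obtain ⟨φ, hφ, h⟩ := hf
  refine ⟨fun x bs => (o x).elim (c, 0) fun y => φ (x, y) bs, ?_, fun π x => ?_⟩
  · refine (Computable.option_casesOn (o := fun p : α × List Bool => o p.1)
      (f := fun _ => ((c, 0) : ℕ × ℕ)) (g := fun p y => φ (p.1, y) p.2)
      (ho.comp Computable.fst) (Computable.const _)
      (hφ.comp ((Computable.fst.comp Computable.fst).pair Computable.snd)
        (Computable.snd.comp Computable.fst))).of_eq fun p => ?_
    cases h : o p.1 <;> simp [h]
  · cases hx : o x with
    | none => simp [hx, tendsto_const_nhds]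
    | some y => simpa only [hx, Option.elim_some] using h π (x, y)

theorem ite (hf : LowerApprox f) {p : α → Prop} [DecidablePred p] (hp : PrimrecPred p) :
    LowerApprox fun π x => if p x then f π x else 0 := by
  obtain ⟨φ, hφ, h⟩ := hf
  refine ⟨fun x bs => if p x then φ x bs else (0, 0), ?_, fun π x => ?_⟩
  · have hd : Computable fun x => decide (p x) := (primrecPred_iff_primrec_decide.1 hp).to_comp
    refine (Computable.cond (c := fun q : α × List Bool => decide (p q.1))
      (f := fun q => φ q.1 q.2) (g := fun _ => ((0, 0) : ℕ × ℕ))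
      (hd.comp Computable.fst) hφ (Computable.const _)).of_eq fun q => ?_
    by_cases hq : p q.1 <;> simp [hq]
  · by_cases hx : p x
    · simpa only [hx, if_true] using h π x
    · simp [hx, tendsto_const_nhds]

/-- A countable sum is lower approximated by cutting it off at a stage which grows with the number
of the answers. -/
theorem tsum {f : (Fin n → Strategy A E) → α × β → ℝ} (hf : LowerApprox f)
    (hs : ∀ π x, Summable fun y => f π (x, y)) : LowerApprox fun π x => ∑' y, f π (x, y) := by
  have hf0 := hf.nonneg
  obtain ⟨φ, hφ, h⟩ := (hf.comp (u := fun p : (α × ℕ) × β => (p.1.1, p.2))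
    ((Computable.fst.comp Computable.fst).pair Computable.snd)).option_elim
    (o := fun p : α × ℕ => Encodable.decode₂ β p.2)
    (Primrec.decode₂.to_comp.comp Computable.snd) 0
  -- the sum over `β` as a sum over codes; `decode₂` counts every element only once
  have hinj := Encodable.encode_injective (α := β)
  have hsupp : ∀ π x, Function.support (fun k : ℕ =>
      (Encodable.decode₂ β k).elim ((0 : ℕ) : ℝ) fun y => f π (x, y)) ⊆
      Set.range (Encodable.encode (α := β)) := by
    intro π x k hk
    by_contra hc
    refine hk ?_
    have : Encodable.decode₂ β k = none := by
      by_contra h'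
      exact hc (Encodable.decode₂_ne_none_iff.1 h')
    simp [this]
  have hsum : ∀ π x, HasSum (fun k : ℕ =>
      (Encodable.decode₂ β k).elim ((0 : ℕ) : ℝ) fun y => f π (x, y)) (∑' y, f π (x, y)) := by
    intro π x
    rw [← hinj.hasSum_iff (fun k hk => by
      by_contra h'
      exact hk (hsupp π x h'))]
    simpa [Function.comp_def, Encodable.encodek₂] using (hs π x).hasSum
  refine ⟨fun x bs => foldUpTo addFrac (0, 0) (fun k => φ (x, k) bs) bs.length,
    computable_foldUpTo primrec_addFrac.to_comp _ (g := fun (p : α × List Bool) k => φ (p.1, k) p.2)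
      (hφ.comp ((Computable.fst.comp Computable.fst).pair Computable.snd)
        (Computable.snd.comp Computable.fst)) (Computable.list_length.comp Computable.snd),
    fun π x => ?_⟩
  simp only [frac_foldUpTo_add]
  have hnn : ∀ k : ℕ, 0 ≤ (Encodable.decode₂ β k).elim ((0 : ℕ) : ℝ) fun y => f π (x, y) := by
    intro k
    cases Encodable.decode₂ β k with
    | none => simp
    | some y => exact hf0 π (x, y)
  have hle : ∀ bs, CorrectAnswers π bs →
      ∑ k ∈ Finset.range bs.length, frac (φ (x, k) bs) ≤ ∑' y, f π (x, y) := fun bs hb =>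
    (Finset.sum_le_sum fun k _ => (h π (x, k)).1 bs hb).trans
      (sum_le_hasSum _ (fun k _ => hnn k) (hsum π x))
  refine ⟨hle, tendsto_order.2 ⟨fun a ha => ?_, fun a ha => ?_⟩⟩
  · obtain ⟨N, hN⟩ := ((hsum π x).tendsto_sum_nat.eventually (lt_mem_nhds ha)).exists
    have h1 : Tendsto (fun bs => ∑ k ∈ Finset.range N, frac (φ (x, k) bs)) (answers π)
        (𝓝 (∑ k ∈ Finset.range N, (Encodable.decode₂ β k).elim ((0 : ℕ) : ℝ)
          fun y => f π (x, y))) :=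
      tendsto_finsetSum _ fun k _ => (h π (x, k)).2
    filter_upwards [h1.eventually (lt_mem_nhds hN),
      (tendsto_length_answers π).eventually (eventually_ge_atTop N)] with bs h2 h3
    exact h2.trans_le (Finset.sum_le_sum_of_subset_of_nonneg
      (Finset.range_subset_range.2 h3) fun k _ _ => frac_nonneg _)
  · filter_upwards [eventually_correctAnswers π] with bs hb
    exact (hle bs hb).trans_lt ha

end LowerApprox

theorem LowerSemicomputable.lowerApprox {α : Type*} [Primcodable α] {f : α → ℝ}
    (hf : LowerSemicomputable f) (h0 : ∀ x, 0 ≤ f x) :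
    LowerApprox fun (_ : Fin n → Strategy A E) x => f x := by
  obtain ⟨φ, hφ, hm, ht⟩ := hf
  refine ⟨fun x bs => posFrac (φ x bs.length), primrec_posFrac.to_comp.comp
    (hφ.comp Computable.fst (Computable.list_length.comp Computable.snd)), fun π x => ?_⟩
  simp only [frac_posFrac]
  refine ⟨fun bs _ => max_le (h0 x) ?_, ?_⟩
  · have hm' : Monotone fun k => (ratOf (φ x k) : ℝ) := fun a b hab =>
      Rat.cast_le.2 (hm x hab)
    exact hm'.ge_of_tendsto (ht x) _
  · have h1 := (ht x).comp (tendsto_length_answers π)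
    have h2 := (tendsto_const_nhds (x := (0 : ℝ))).max h1
    rw [max_eq_right (h0 x)] at h2
    exact h2

/-- The estimate of precision `1 / (k + 1)`, decreased by `1 / (k + 1)`, is a lower bound. -/
theorem Estimable.lowerApprox {α : Type*} [Primcodable α] {f : α → ℝ}
    (hf : Estimable f) (h0 : ∀ x, 0 ≤ f x) :
    LowerApprox fun (_ : Fin n → Strategy A E) x => f x := by
  obtain ⟨φ, hφ, h⟩ := hf
  have hk : Computable fun p : α × List Bool => p.2.length :=
    Computable.list_length.comp Computable.snd
  refine ⟨fun x bs => posFrac (subRat (φ x bs.length) (1, 0, bs.length)),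
    primrec_posFrac.to_comp.comp (primrec_subRat.to_comp.comp (hφ.comp Computable.fst hk)
      ((Computable.const 1).pair ((Computable.const 0).pair hk))), fun π x => ?_⟩
  have h1 : ∀ k : ℕ, (ratOf (1, 0, k) : ℝ) = 1 / ((k : ℝ) + 1) := fun k => by simp [ratOf]
  simp only [frac_posFrac, ratOf_subRat]
  push_cast
  simp only [h1]
  refine ⟨fun bs _ => max_le (h0 x) (by linarith [(abs_lt.1 (h x bs.length)).1]), ?_⟩
  have h2 := tendsto_one_div_add_atTop_nhds_zero_nat (𝕜 := ℝ)
  have h3 : Tendsto (fun k => (ratOf (φ x k) : ℝ)) atTop (𝓝 (f x)) := by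
    rw [tendsto_iff_dist_tendsto_zero]
    refine squeeze_zero (fun _ => dist_nonneg) (fun k => ?_) h2
    rw [Real.dist_eq, abs_sub_comm]
    exact (h x k).le
  have h4 := (tendsto_const_nhds (x := (0 : ℝ))).max
    ((h3.sub h2).comp (tendsto_length_answers π))
  rw [sub_zero, max_eq_right (h0 x)] at h4
  exact h4

open Classical in
/-- The probabilities with which the players act are lower approximable: they are the suprema of
the rational numbers about which the answer is `1`. -/
theorem lowerApprox_strategy :
    LowerApprox fun (π : Fin n → Strategy A E) (x : Fin n × List (A × E) × A) =>
      π x.1 x.2.1 x.2.2 := by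
  let hit : (Fin n × List (A × E) × A) × List Bool → ℕ → Question n A E → ℕ × ℕ := fun p s q =>
    if q.1 = p.1.1 ∧ q.2.1 = p.1.2.1 ∧ q.2.2.2 = p.1.2.2 ∧ p.2[s]? = some true ∧
      q.2.2.1.1 ≤ q.2.2.1.2 + 1 then q.2.2.1 else (0, 0)
  let g : (Fin n × List (A × E) × A) × List Bool → ℕ → ℕ × ℕ := fun p s =>
    (Encodable.decode (α := Question n A E) s).elim (0, 0) (hit p s)
  have hg : Computable₂ g := by
    have hhit : Primrec₂ fun (p : ((Fin n × List (A × E) × A) × List Bool) × ℕ)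
        (q : Question n A E) => hit p.1 p.2 q := by
      have P : Primrec fun u : (((Fin n × List (A × E) × A) × List Bool) × ℕ) × Question n A E =>
        u.1.1 := Primrec.fst.comp Primrec.fst
      have P1 := Primrec.fst.comp P
      have Q : Primrec fun u : (((Fin n × List (A × E) × A) × List Bool) × ℕ) × Question n A E =>
        u.2 := Primrec.snd
      have Q2 := Primrec.snd.comp Q
      have Q22 := Primrec.snd.comp Q2
      have Z := Primrec.fst.comp Q22
      refine Primrec.ite (PrimrecPred.and (Primrec.eq.comp (Primrec.fst.comp Q)
        (Primrec.fst.comp P1)) (PrimrecPred.and (Primrec.eq.comp (Primrec.fst.comp Q2)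
        (Primrec.fst.comp (Primrec.snd.comp P1))) (PrimrecPred.and (Primrec.eq.comp
        (Primrec.snd.comp Q22) (Primrec.snd.comp (Primrec.snd.comp P1))) (PrimrecPred.and
        (Primrec.eq.comp (Primrec.list_getElem?.comp (Primrec.snd.comp P)
          (Primrec.snd.comp Primrec.fst)) (Primrec.const (some true)))
        (Primrec.nat_le.comp (Primrec.fst.comp Z) (Primrec.succ.comp (Primrec.snd.comp Z)))))))
        Z (Primrec.const _)
    refine (Computable.option_casesOn (f := fun _ => ((0, 0) : ℕ × ℕ))
      (g := fun (p : ((Fin n × List (A × E) × A) × List Bool) × ℕ) q => hit p.1 p.2 q)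
      (Computable.decode.comp Computable.snd) (Computable.const _) hhit.to_comp).of_eq fun p => ?_
    simp only [g]
    cases Encodable.decode (α := Question n A E) p.2 <;> simp
  have hq : ∀ z : ℕ × ℕ, z.1 ≤ z.2 + 1 → ((queryRat z : ℚ) : ℝ) = frac z := by
    intro z hz
    have hz' : (z.1 : ℚ) / (z.2 + 1) ≤ 1 := by
      rw [div_le_one (by positivity)]
      exact_mod_cast hz
    simp only [queryRat, frac]
    rw [min_eq_right hz']
    push_cast
    rfl
  refine ⟨fun x bs => foldUpTo maxFrac (0, 0) (g (x, bs)) bs.length,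
    computable_foldUpTo primrec_maxFrac.to_comp _ hg (Computable.list_length.comp Computable.snd),
    fun π x => ?_⟩
  have h0 : 0 ≤ π x.1 x.2.1 x.2.2 := (π x.1 x.2.1).2.1 _
  have hle : ∀ bs, CorrectAnswers π bs →
      frac (foldUpTo maxFrac (0, 0) (g (x, bs)) bs.length) ≤ π x.1 x.2.1 x.2.2 := by
    intro bs hb
    refine frac_foldUpTo_max_le _ _ h0 fun s => ?_
    simp only [g]
    cases hs : Encodable.decode (α := Question n A E) s with
    | none => simp [h0]
    | some q =>
      simp only [Option.elim_some, hit]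
      split_ifs with hc
      · obtain ⟨h1, h2, h3, h4, h5⟩ := hc
        rw [← hq _ h5, ← h1, ← h2, ← h3]
        exact (hb s q true hs h4).1 rfl
      · simp [h0]
  refine ⟨hle, tendsto_order.2 ⟨fun c hc => ?_, fun c hc => ?_⟩⟩
  · rcases lt_or_ge c 0 with h | h
    · exact Eventually.of_forall fun bs => h.trans_le (frac_nonneg _)
    -- ask about a rational number between `c` and the probability
    obtain ⟨y, hy1, hy2⟩ := exists_rat_btwn hc
    have hy0 : 0 < y := by exact_mod_cast h.trans_lt hy1
    have hy1' : (y : ℝ) ≤ 1 := hy2.le.trans (by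
      rw [← (π x.1 x.2.1).2.2]
      exact Finset.single_le_sum (f := fun a => (π x.1 x.2.1 : A → ℝ) a)
        (fun a _ => (π x.1 x.2.1).2.1 a) (Finset.mem_univ _))
    have hyf : frac (y.num.toNat, y.den - 1) = y := by
      have hd : ((y.den - 1 : ℕ) : ℝ) + 1 = y.den := by
        rw [Nat.cast_sub y.pos]; simp
      have hn : ((y.num.toNat : ℕ) : ℝ) = (y.num : ℝ) := by
        exact_mod_cast congrArg (Int.cast (R := ℝ)) (Int.toNat_of_nonneg (Rat.num_pos.2 hy0).le)
      rw [frac, hd, hn]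
      exact (Rat.cast_def y).symm
    have hyle : y.num.toNat ≤ y.den - 1 + 1 := by
      have := hyf ▸ hy1'
      rw [frac, div_le_one (by positivity)] at this
      exact_mod_cast this
    let q : Question n A E := (x.1, x.2.1, (y.num.toNat, y.den - 1), x.2.2)
    filter_upwards [
      (tendsto_length_answers π).eventually (eventually_gt_atTop (Encodable.encode q)),
      eventually_correctAnswers π] with bs hl hb
    have htrue : bs[Encodable.encode q]? = some true := by
      rw [List.getElem?_eq_getElem hl]
      by_contra hc'
      have hfalse : bs[Encodable.encode q]? = some false := by
        rw [List.getElem?_eq_getElem hl]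
        simpa using hc'
      have := (hb _ q false (Encodable.encodek q) hfalse).2 rfl
      simp only [q] at this
      rw [hq _ hyle, hyf] at this
      exact absurd hy2 (not_lt.2 this)
    refine lt_of_lt_of_le ?_ (le_frac_foldUpTo_max _ hl)
    simp only [g, Encodable.encodek, Option.elim_some, hit]
    rw [if_pos ⟨rfl, rfl, rfl, htrue, hyle⟩]
    exact hyf ▸ hy1
  · filter_upwards [eventually_correctAnswers π] with bs hb
    exact (hle bs hb).trans_lt hc

end LowerApprox

/-! ### Unnormalized values -/

section Values

variable {A E : Type*} {ν : List (A × E) → ℝ}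

/-- Chronological action-contextual measures: nonnegative, and the probabilities of the next
percept add up. -/
structure IsContextual [Fintype E] (ν : List (A × E) → ℝ) : Prop where
  nonneg : ∀ h, 0 ≤ ν h
  sum_append : ∀ h a, ∑ e, ν (h ++ [(a, e)]) = ν h

/-- The probability that the percepts are not those of `h` when player `i` takes the actions in
`h`: there is a first round in which the percept differs. -/
theorem one_sub_contextual [Fintype E] [DecidableEq E] (hν : IsContextual ν) (hnil : ν [] = 1)
    (h : List (A × E)) :
    1 - ν h = ∑ t ∈ Finset.range h.length, (h[t]?).elim 0 fun x =>
      ∑ e, if e ≠ x.2 then ν (h.take t ++ [(x.1, e)]) else 0 := by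
  induction h using List.reverseRecOn with
  | nil => simp [hnil]
  | append_singleton h x ih =>
    rw [List.length_append, List.length_singleton, Finset.sum_range_succ]
    have h1 : ∀ t ∈ Finset.range h.length, ((h ++ [x])[t]?).elim (0 : ℝ) (fun x' =>
        ∑ e, if e ≠ x'.2 then ν ((h ++ [x]).take t ++ [(x'.1, e)]) else 0) =
        (h[t]?).elim 0 fun x' => ∑ e, if e ≠ x'.2 then ν (h.take t ++ [(x'.1, e)]) else 0 := by
      intro t ht
      have ht' := Finset.mem_range.1 ht
      rw [List.getElem?_append_left ht', List.take_append_of_le_length ht'.le]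
    rw [Finset.sum_congr rfl h1, ← ih]
    have h2 : ∑ e, (if e ≠ x.2 then ν (h ++ [(x.1, e)]) else 0) = ν h - ν (h ++ [x]) := by
      rw [← hν.sum_append h x.1, ← Finset.sum_filter, Finset.filter_ne',
        ← Finset.add_sum_erase _ _ (Finset.mem_univ x.2)]
      ring
    rw [List.getElem?_append_right le_rfl, Nat.sub_self, List.take_append_of_le_length le_rfl,
      List.take_length]
    change _ = _ + ∑ e, if e ≠ x.2 then ν (h ++ [(x.1, e)]) else 0
    rw [h2]
    ring

/-- This is true also if `ν h = 0`, because the extensions of `h` then have probability `0`, too. -/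
theorem envCond_mul_self [Fintype E] (hν : IsContextual ν) (h : List (A × E)) (x : A × E) :
    ν h * envCond ν h x.1 x.2 = ν (h ++ [x]) := by
  rw [envCond]
  by_cases h0 : ν h = 0
  · have h1 := hν.sum_append h x.1
    rw [h0, Finset.sum_eq_zero_iff_of_nonneg fun e _ => hν.nonneg _] at h1
    rw [h0, zero_mul]
    exact (h1 x.2 (Finset.mem_univ _)).symm
  · exact mul_div_cancel₀ _ h0

section

variable [Fintype A] {π : Strategy A E}

theorem strategy_nonneg (π : Strategy A E) (h : List (A × E)) (a : A) : 0 ≤ π h a := (π h).2.1 a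

theorem strategy_sum (π : Strategy A E) (h : List (A × E)) : ∑ a, π h a = 1 := (π h).2.2

/-- The conditional probability of the next `m` rounds given `h`. -/
def pathProb (ν : List (A × E) → ℝ) (π : Strategy A E) (h : List (A × E)) {m : ℕ}
    (g : Fin m → A × E) : ℝ :=
  ∏ k : Fin m, π (h ++ (List.ofFn g).take k) (g k).1 *
    envCond ν (h ++ (List.ofFn g).take k) (g k).1 (g k).2

theorem pathProb_cons (h : List (A × E)) {m : ℕ} (x : A × E) (g : Fin m → A × E) :
    pathProb ν π h (Fin.cons x g : Fin (m + 1) → A × E) =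
      π h x.1 * envCond ν h x.1 x.2 * pathProb ν π (h ++ [x]) g := by
  rw [pathProb, Fin.prod_univ_succ, pathProb]
  congr 1
  · simp
  · refine Finset.prod_congr rfl fun k _ => ?_
    simp [List.ofFn_succ]

/-- The probability with which `π` takes the actions in the continuation `g` of the history `h`. -/
def selfProb (π : Strategy A E) : List (A × E) → List (A × E) → ℝ
  | _, [] => 1
  | h, x :: g => π h x.1 * selfProb π (h ++ [x]) g

theorem selfProb_eq (h g : List (A × E)) :
    selfProb π h g =
      ∏ k ∈ Finset.range g.length, (g[k]?).elim 1 fun x => π (h ++ g.take k) x.1 := by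
  induction g generalizing h with
  | nil => simp [selfProb]
  | cons x g ih =>
    rw [selfProb, ih, List.length_cons, Finset.prod_range_succ', mul_comm]
    simp

theorem selfProb_nonneg (h g : List (A × E)) : 0 ≤ selfProb π h g := by
  induction g generalizing h with
  | nil => simp [selfProb]
  | cons x g ih => exact mul_nonneg (strategy_nonneg π h _) (ih _)

end

variable [Fintype A] [Fintype E]

/-- The expected discounted reward in the round which follows `h`, times the probability of `h`. -/
def stageReward (ρ : E → ℝ) (γ : ℕ → ℝ) (ν : List (A × E) → ℝ) (π : Strategy A E)
    (h : List (A × E)) : ℝ :=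
  γ h.length * ∑ x : A × E, π h x.1 * (ρ x.2 * ν (h ++ [x]))

/-- The expected discounted reward in the `m`-th round (from zero) after `h`, times the probability
of `h`. -/
def layerValue (ρ : E → ℝ) (γ : ℕ → ℝ) (ν : List (A × E) → ℝ) (π : Strategy A E) :
    ℕ → List (A × E) → ℝ
  | 0, h => stageReward ρ γ ν π h
  | m + 1, h => ∑ x : A × E, π h x.1 * layerValue ρ γ ν π m (h ++ [x])

/-- The value of `π` at `h`, times `Γ` and the probability of `h`. Without the two normalizations
no division by a probability which may vanish is needed. -/
def futureValue (ρ : E → ℝ) (γ : ℕ → ℝ) (ν : List (A × E) → ℝ) (π : Strategy A E)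
    (h : List (A × E)) : ℝ :=
  ∑' m, layerValue ρ γ ν π m h

/-- The unnormalized value of taking action `a` at `h` and following `π` afterwards. -/
def actionValue (ρ : E → ℝ) (γ : ℕ → ℝ) (ν : List (A × E) → ℝ) (π : Strategy A E)
    (h : List (A × E)) (a : A) : ℝ :=
  ∑ e, (γ h.length * (ρ e * ν (h ++ [(a, e)])) + futureValue ρ γ ν π (h ++ [(a, e)]))

variable {ρ : E → ℝ} {γ : ℕ → ℝ} {π : Strategy A E}

theorem sum_strategy_mul_append (hν : IsContextual ν) (π : Strategy A E) (h : List (A × E)) :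
    ∑ x : A × E, π h x.1 * ν (h ++ [x]) = ν h := by
  rw [Fintype.sum_prod_type]
  simp only [← Finset.mul_sum, hν.sum_append, ← Finset.sum_mul, strategy_sum, one_mul]

theorem layerValue_nonneg (hν : IsContextual ν) (hγ : ∀ k, 0 ≤ γ k) (hρ : ∀ e, 0 ≤ ρ e)
    (m : ℕ) (h : List (A × E)) : 0 ≤ layerValue ρ γ ν π m h := by
  induction m generalizing h with
  | zero =>
    exact mul_nonneg (hγ _) (Finset.sum_nonneg fun x _ =>
      mul_nonneg (strategy_nonneg π h _) (mul_nonneg (hρ _) (hν.nonneg _)))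
  | succ m ih =>
    exact Finset.sum_nonneg fun x _ => mul_nonneg (strategy_nonneg π h _) (ih _)

/-- A reward `ρ` and the complementary reward `1 - ρ` add up to the constant reward `1`. -/
theorem layerValue_add_compl (hν : IsContextual ν) (m : ℕ) (h : List (A × E)) :
    layerValue ρ γ ν π m h + layerValue (fun e => 1 - ρ e) γ ν π m h =
      γ (h.length + m) * ν h := by
  induction m generalizing h with
  | zero =>
    simp only [layerValue, stageReward]
    rw [← mul_add, ← Finset.sum_add_distrib, ← sum_strategy_mul_append hν π h, add_zero]
    congr 1
    exact Finset.sum_congr rfl fun x _ => by ring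
  | succ m ih =>
    simp only [layerValue]
    rw [← Finset.sum_add_distrib, ← sum_strategy_mul_append hν π h, Finset.mul_sum]
    refine Finset.sum_congr rfl fun x _ => ?_
    rw [← mul_add, ih]
    simp only [List.length_append, List.length_singleton]
    rw [show h.length + 1 + m = h.length + (m + 1) by ring]
    ring

theorem layerValue_le (hν : IsContextual ν) (hγ : ∀ k, 0 ≤ γ k) (hρ : ∀ e, ρ e ∈ Set.Icc (0 : ℝ) 1)
    (m : ℕ) (h : List (A × E)) : layerValue ρ γ ν π m h ≤ γ (h.length + m) * ν h := by
  rw [← layerValue_add_compl (ρ := ρ) (π := π) hν]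
  exact le_add_of_nonneg_right
    (layerValue_nonneg hν hγ (fun e => sub_nonneg.2 (hρ e).2) m h)

theorem summable_shift (hγs : Summable γ) (t : ℕ) : Summable fun k => γ (t + k) := by
  simpa only [add_comm t] using (summable_nat_add_iff t).2 hγs

theorem summable_layerValue (hν : IsContextual ν) (hγ : ∀ k, 0 ≤ γ k) (hγs : Summable γ)
    (hρ : ∀ e, ρ e ∈ Set.Icc (0 : ℝ) 1) (h : List (A × E)) :
    Summable fun m => layerValue ρ γ ν π m h :=
  Summable.of_nonneg_of_le (fun m => layerValue_nonneg hν hγ (fun e => (hρ e).1) m h)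
    (fun m => layerValue_le hν hγ hρ m h) ((summable_shift hγs h.length).mul_right _)

theorem futureValue_nonneg (hν : IsContextual ν) (hγ : ∀ k, 0 ≤ γ k) (hρ : ∀ e, 0 ≤ ρ e)
    (h : List (A × E)) : 0 ≤ futureValue ρ γ ν π h :=
  tsum_nonneg fun m => layerValue_nonneg hν hγ hρ m h

theorem discountNorm_eq (hγs : Summable γ) (t : ℕ) :
    discountNorm γ t = γ t + discountNorm γ (t + 1) := by
  rw [discountNorm, (summable_shift hγs t).tsum_eq_zero_add, discountNorm, add_zero]
  simp only [add_assoc, add_comm 1]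

theorem discountNorm_nonneg (hγ : ∀ k, 0 ≤ γ k) (t : ℕ) : 0 ≤ discountNorm γ t :=
  tsum_nonneg fun _ => hγ _

theorem discountNorm_le_zero (hγ : ∀ k, 0 ≤ γ k) (hγs : Summable γ) (t : ℕ) :
    discountNorm γ t ≤ discountNorm γ 0 := by
  induction t with
  | zero => exact le_rfl
  | succ t ih => linarith [discountNorm_eq hγs t, hγ t]

theorem futureValue_add_compl (hν : IsContextual ν) (hγ : ∀ k, 0 ≤ γ k) (hγs : Summable γ)
    (hρ : ∀ e, ρ e ∈ Set.Icc (0 : ℝ) 1) (h : List (A × E)) :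
    futureValue ρ γ ν π h + futureValue (fun e => 1 - ρ e) γ ν π h =
      discountNorm γ h.length * ν h := by
  have hρ' : ∀ e, 1 - ρ e ∈ Set.Icc (0 : ℝ) 1 := fun e =>
    ⟨sub_nonneg.2 (hρ e).2, sub_le_self _ (hρ e).1⟩
  rw [futureValue, futureValue, ← (summable_layerValue hν hγ hγs hρ h).tsum_add
    (summable_layerValue hν hγ hγs hρ' h), discountNorm, ← tsum_mul_right]
  exact tsum_congr fun m => layerValue_add_compl hν m h

theorem actionValue_add_compl (hν : IsContextual ν) (hγ : ∀ k, 0 ≤ γ k) (hγs : Summable γ)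
    (hρ : ∀ e, ρ e ∈ Set.Icc (0 : ℝ) 1) (h : List (A × E)) (a : A) :
    actionValue ρ γ ν π h a + actionValue (fun e => 1 - ρ e) γ ν π h a =
      discountNorm γ h.length * ν h := by
  rw [actionValue, actionValue, ← Finset.sum_add_distrib, ← hν.sum_append h a, Finset.mul_sum]
  refine Finset.sum_congr rfl fun e _ => ?_
  have := futureValue_add_compl (π := π) hν hγ hγs hρ (h ++ [(a, e)])
  rw [List.length_append, List.length_singleton] at this
  rw [discountNorm_eq hγs h.length, add_mul, ← this]
  ring

theorem futureValue_eq (hν : IsContextual ν) (hγ : ∀ k, 0 ≤ γ k) (hγs : Summable γ)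
    (hρ : ∀ e, ρ e ∈ Set.Icc (0 : ℝ) 1) (h : List (A × E)) :
    futureValue ρ γ ν π h = ∑ a, π h a * actionValue ρ γ ν π h a := by
  rw [futureValue, (summable_layerValue hν hγ hγs hρ h).tsum_eq_zero_add]
  have h1 : ∑' m, layerValue ρ γ ν π (m + 1) h =
      ∑ x : A × E, π h x.1 * futureValue ρ γ ν π (h ++ [x]) := by
    simp only [layerValue, futureValue]
    rw [Summable.tsum_finsetSum fun x _ => (summable_layerValue hν hγ hγs hρ _).mul_left _]
    simp only [tsum_mul_left]
  rw [h1, layerValue, stageReward, Finset.mul_sum, ← Finset.sum_add_distrib,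
    Fintype.sum_prod_type]
  refine Finset.sum_congr rfl fun a _ => ?_
  rw [actionValue, Finset.mul_sum]
  exact Finset.sum_congr rfl fun e _ => by ring

/-- If `π` only takes actions which maximize its own action values, then its future value is an
upper bound of what any other strategy `π'` gains within `m` rounds. -/
theorem sum_layerValue_le_futureValue (hν : IsContextual ν) (hγ : ∀ k, 0 ≤ γ k) (hγs : Summable γ)
    (hρ : ∀ e, ρ e ∈ Set.Icc (0 : ℝ) 1)
    (hπ : ∀ h a, π h a ≠ 0 → ∀ b, actionValue ρ γ ν π h b ≤ actionValue ρ γ ν π h a)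
    (π' : Strategy A E) (m : ℕ) (h : List (A × E)) :
    ∑ k ∈ Finset.range m, layerValue ρ γ ν π' k h ≤ futureValue ρ γ ν π h := by
  induction m generalizing h with
  | zero => simpa using futureValue_nonneg hν hγ (fun e => (hρ e).1) h
  | succ m ih =>
    rw [Finset.sum_range_succ']
    simp only [layerValue, stageReward]
    rw [Finset.sum_comm, Finset.mul_sum, ← Finset.sum_add_distrib, Fintype.sum_prod_type]
    -- one step of `π'`, then `π`
    have h1 : ∀ b, ∑ e, (∑ k ∈ Finset.range m, π' h b * layerValue ρ γ ν π' k (h ++ [(b, e)]) +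
        γ h.length * (π' h b * (ρ e * ν (h ++ [(b, e)])))) ≤
        π' h b * actionValue ρ γ ν π h b := by
      intro b
      rw [actionValue, Finset.mul_sum]
      refine Finset.sum_le_sum fun e _ => ?_
      rw [← Finset.mul_sum]
      have := mul_le_mul_of_nonneg_left (ih (h ++ [(b, e)])) (strategy_nonneg π' h b)
      linarith
    have h2 : ∀ b, actionValue ρ γ ν π h b ≤ futureValue ρ γ ν π h := by
      intro b
      rw [futureValue_eq hν hγ hγs hρ, ← one_mul (actionValue ρ γ ν π h b),
        ← strategy_sum π h, Finset.sum_mul]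
      refine Finset.sum_le_sum fun a _ => ?_
      by_cases ha : π h a = 0
      · simp [ha]
      · exact mul_le_mul_of_nonneg_left (hπ h a ha b) (strategy_nonneg π h a)
    calc _ ≤ ∑ b, π' h b * actionValue ρ γ ν π h b := Finset.sum_le_sum fun b _ => h1 b
      _ ≤ ∑ b, π' h b * futureValue ρ γ ν π h := Finset.sum_le_sum fun b _ =>
          mul_le_mul_of_nonneg_left (h2 b) (strategy_nonneg π' h b)
      _ = futureValue ρ γ ν π h := by rw [← Finset.sum_mul, strategy_sum, one_mul]

/-! ### Values and unnormalized values -/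

theorem sum_cons {X : Type*} [Fintype X] {m : ℕ} (F : (Fin (m + 1) → X) → ℝ) :
    ∑ g, F g = ∑ x, ∑ g : Fin m → X, F (Fin.cons x g) := by
  rw [← (Fin.consEquiv fun _ : Fin (m + 1) => X).sum_comp, Fintype.sum_prod_type]
  rfl

/-- The conditional probabilities of the continuations of `h` add up to `1`, unless `h` has
probability `0`. -/
theorem sum_pathProb (hν : IsContextual ν) (π : Strategy A E) (m : ℕ) (h : List (A × E)) :
    ν h * ∑ g : Fin m → A × E, pathProb ν π h g = ν h := by
  induction m generalizing h with
  | zero => simp [pathProb]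
  | succ m ih =>
    rw [sum_cons]
    simp only [pathProb_cons]
    simp only [← Finset.mul_sum]
    rw [Finset.mul_sum]
    conv_rhs => rw [← sum_strategy_mul_append hν π h]
    refine Finset.sum_congr rfl fun x _ => ?_
    rw [← ih (h ++ [x])]
    conv_rhs => rw [← envCond_mul_self hν h x]
    ring

/-- The values with a finite horizon, which multiply conditional probabilities, are partial
sums of the unnormalized value. This holds at histories of probability `0` as well, where both sides
vanish. -/
theorem mul_finiteValue (hν : IsContextual ν) (π : Strategy A E) (m : ℕ) (h : List (A × E)) :
    ν h * finiteValue ρ γ ν π h m = ∑ k ∈ Finset.range m, layerValue ρ γ ν π k h := by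
  induction m generalizing h with
  | zero => simp [finiteValue]
  | succ m ih =>
    have h1 : finiteValue ρ γ ν π h (m + 1) = ∑ x : A × E, π h x.1 * envCond ν h x.1 x.2 *
        (γ h.length * ρ x.2 * ∑ g : Fin m → A × E, pathProb ν π (h ++ [x]) g +
          finiteValue ρ γ ν π (h ++ [x]) m) := by
      change ∑ g : Fin (m + 1) → A × E, (∑ k : Fin (m + 1), γ (h.length + k) * ρ (g k).2) *
        pathProb ν π h g = _
      rw [sum_cons]
      refine Finset.sum_congr rfl fun x _ => ?_
      change _ = π h x.1 * envCond ν h x.1 x.2 *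
        (γ h.length * ρ x.2 * ∑ g : Fin m → A × E, pathProb ν π (h ++ [x]) g +
          ∑ g : Fin m → A × E, (∑ k : Fin m, γ ((h ++ [x]).length + k) * ρ (g k).2) *
            pathProb ν π (h ++ [x]) g)
      rw [Finset.mul_sum, ← Finset.sum_add_distrib, Finset.mul_sum]
      refine Finset.sum_congr rfl fun g _ => ?_
      rw [pathProb_cons, Fin.sum_univ_succ]
      have h2 : ∀ k : Fin m, h.length + (k.succ : ℕ) = (h ++ [x]).length + k := fun k => by
        simp; ring
      simp only [Fin.cons_zero, Fin.cons_succ, Fin.val_zero, add_zero, h2]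
      ring
    rw [h1, Finset.sum_range_succ']
    simp only [layerValue, stageReward]
    rw [Finset.sum_comm, Finset.mul_sum, Finset.mul_sum, ← Finset.sum_add_distrib]
    refine Finset.sum_congr rfl fun x _ => ?_
    have h3 := sum_pathProb hν π m (h ++ [x])
    rw [← Finset.mul_sum, ← ih]
    rw [← envCond_mul_self hν h x] at h3 ⊢
    linear_combination π h x.1 * γ h.length * ρ x.2 * h3

/-- A strategy is optimal if its actions maximize its own action values: no strategy which deviates
only once is better. -/
theorem isOptimal_of_greedy (hν : IsContextual ν) (hγ : ∀ k, 0 ≤ γ k) (hγs : Summable γ)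
    (hρ : ∀ e, ρ e ∈ Set.Icc (0 : ℝ) 1)
    (hπ : ∀ h a, π h a ≠ 0 → ∀ b, actionValue ρ γ ν π h b ≤ actionValue ρ γ ν π h a) :
    IsOptimal ρ γ ν π := by
  intro h hh π'
  have h1 : ∀ π' : Strategy A E, Tendsto (finiteValue ρ γ ν π' h) atTop
      (𝓝 (futureValue ρ γ ν π' h / ν h)) := by
    intro π'
    have h2 := ((summable_layerValue (π := π') hν hγ hγs hρ h).hasSum.tendsto_sum_nat).div_const
      (ν h)
    refine h2.congr fun m => ?_
    rw [← mul_finiteValue hν, mul_div_cancel_left₀ _ hh.ne']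
  rw [value, value, (h1 π').limUnder_eq, (h1 π).limUnder_eq]
  refine mul_le_mul_of_nonneg_left ?_ (one_div_nonneg.2 (discountNorm_nonneg hγ _))
  refine div_le_div_of_nonneg_right ?_ hh.le
  exact le_of_tendsto' (summable_layerValue (π := π') hν hγ hγs hρ h).hasSum.tendsto_sum_nat
    fun m => sum_layerValue_le_futureValue hν hγ hγs hρ hπ π' m h

/-! ### The future value as a sum over continuations -/

theorem layerValue_eq_sum (m : ℕ) (h : List (A × E)) :
    layerValue ρ γ ν π m h = ∑ g : Fin m → A × E,
      selfProb π h (List.ofFn g) * stageReward ρ γ ν π (h ++ List.ofFn g) := by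
  induction m generalizing h with
  | zero => simp [layerValue, selfProb]
  | succ m ih =>
    rw [layerValue, sum_cons]
    refine Finset.sum_congr rfl fun x _ => ?_
    rw [ih, Finset.mul_sum]
    refine Finset.sum_congr rfl fun g _ => ?_
    simp [List.ofFn_succ, selfProb, mul_assoc]

theorem hasSum_futureValue (hν : IsContextual ν) (hγ : ∀ k, 0 ≤ γ k) (hγs : Summable γ)
    (hρ : ∀ e, ρ e ∈ Set.Icc (0 : ℝ) 1) (h : List (A × E)) :
    HasSum (fun g => selfProb π h g * stageReward ρ γ ν π (h ++ g)) (futureValue ρ γ ν π h) := by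
  rw [← List.equivSigmaTuple.symm.hasSum_iff]
  have hsum := summable_layerValue (π := π) hν hγ hγs hρ h
  have h1 : ∀ m, HasSum (fun g : Fin m → A × E =>
      selfProb π h (List.ofFn g) * stageReward ρ γ ν π (h ++ List.ofFn g))
      (layerValue ρ γ ν π m h) := fun m => by
    rw [layerValue_eq_sum]; exact hasSum_fintype _
  have h2 : Summable fun p : Σ m, Fin m → A × E =>
      selfProb π h (List.ofFn p.2) * stageReward ρ γ ν π (h ++ List.ofFn p.2) := by
    refine (summable_sigma_of_nonneg fun p => ?_).2 ⟨fun m => (h1 m).summable, ?_⟩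
    · exact mul_nonneg (selfProb_nonneg _ _)
        (layerValue_nonneg hν hγ (fun e => (hρ e).1) 0 _)
    · simpa only [(h1 _).tsum_eq] using hsum
  have h3 := h2.hasSum.sigma h1
  have h4 := hsum.hasSum.unique h3
  rw [futureValue, h4]
  exact h2.hasSum

end Values

/-! ### Subjective environments -/

section Subjective

variable {A E : Type*} [Fintype A] [Fintype E] {n : ℕ}

theorem contextProb_nonneg (σ : Game n A E) (π : Fin n → Strategy A E) (i : Fin n)
    (l : List (Round n A E)) : 0 ≤ contextProb σ π i l :=
  Finset.prod_nonneg fun _ _ => mul_nonneg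
    (Finset.prod_nonneg fun j _ => strategy_nonneg (π j) _ _) ((σ _ _).2.1 _)

theorem contextProb_eq (σ : Game n A E) (π : Fin n → Strategy A E) (i : Fin n)
    (l : List (Round n A E)) :
    contextProb σ π i l = ∏ t ∈ Finset.range l.length, (l[t]?).elim 1 fun x =>
      (∏ j ∈ Finset.univ.erase i, π j (playerHistory j (l.take t)) (x.1 j)) *
        σ (l.take t) x.1 x.2 := by
  rw [contextProb, Finset.prod_range]
  exact Finset.prod_congr rfl fun t _ => by simp

variable [DecidableEq A] [DecidableEq E]

theorem isContextual_subjectiveEnv (σ : Game n A E) (π : Fin n → Strategy A E) (i : Fin n) :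
    IsContextual (subjectiveEnv σ π i) where
  nonneg h := Finset.sum_nonneg fun g _ => by
    split_ifs
    · exact contextProb_nonneg σ π i _
    · exact le_rfl
  sum_append h a := sum_subjectiveEnv σ π i h a

theorem subjectiveEnv_nil (σ : Game n A E) (π : Fin n → Strategy A E) (i : Fin n) :
    subjectiveEnv σ π i [] = 1 := by
  change ∑ g : Fin 0 → Round n A E, (if playerHistory i (List.ofFn g) = [] then
    contextProb σ π i (List.ofFn g) else 0) = 1
  rw [Fintype.sum_unique]
  exact if_pos rfl

theorem hasSum_subjectiveEnv (σ : Game n A E) (π : Fin n → Strategy A E) (i : Fin n)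
    (h : List (A × E)) :
    HasSum (fun l => if playerHistory i l = h then contextProb σ π i l else 0)
      (subjectiveEnv σ π i h) := by
  have h1 := hasSum_sum_of_ne_finset_zero (L := SummationFilter.unconditional _)
    (f := fun l => if playerHistory i l = h then contextProb σ π i l else 0)
    (s := Finset.univ.map ⟨fun g : Fin h.length → Round n A E => List.ofFn g,
      List.ofFn_injective⟩) (by
    intro l hl
    rw [if_neg]
    rintro rfl
    have hlen : (playerHistory i l).length = l.length := by simp [playerHistory]
    refine hl (Finset.mem_map.2 ⟨fun k => l.get (k.cast hlen), Finset.mem_univ _, ?_⟩)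
    change List.ofFn (fun k => l.get (k.cast hlen)) = l
    rw [← List.ofFn_congr hlen.symm, List.ofFn_get])
  rw [Finset.sum_map] at h1
  exact h1

end Subjective

/-! ### Lower approximation of action values -/

section ActionValues

variable {A E : Type*} [Primcodable A] [Primcodable E] {n : ℕ}

theorem primrec_playerHistory (j : Fin n) :
    Primrec (playerHistory j : List (Round n A E) → List (A × E)) :=
  Primrec.list_map Primrec.id (Primrec.pair
    (Primrec.fin_app.comp (Primrec.fst.comp Primrec.snd) (Primrec.const j))
    (Primrec.fin_app.comp (Primrec.snd.comp Primrec.snd) (Primrec.const j))).to₂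

theorem primrec_append_singleton : Primrec₂ fun (h : List (A × E)) (x : A × E) => h ++ [x] :=
  Primrec.list_concat

variable [Fintype A]

theorem LowerApprox.strategy {α : Type*} [Primcodable α] (j : Fin n) {h : α → List (A × E)}
    {a : α → A} (hh : Primrec h) (ha : Primrec a) :
    LowerApprox fun (π : Fin n → Strategy A E) x => π j (h x) (a x) :=
  lowerApprox_strategy.comp (Primrec.pair (Primrec.const j) (Primrec.pair hh ha)).to_comp

theorem lowerApprox_selfProb (i : Fin n) :
    LowerApprox fun (π : Fin n → Strategy A E) (p : List (A × E) × List (A × E)) =>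
      selfProb (π i) p.1 p.2 := by
  have h1 : LowerApprox fun (π : Fin n → Strategy A E)
      (p : ((List (A × E) × List (A × E)) × ℕ) × (A × E)) =>
      π i (p.1.1.1 ++ p.1.1.2.take p.1.2) p.2.1 :=
    LowerApprox.strategy i (Primrec.list_append.comp
      (Primrec.fst.comp (Primrec.fst.comp Primrec.fst))
      (Primrec.list_take.comp (Primrec.snd.comp Primrec.fst)
        (Primrec.snd.comp (Primrec.fst.comp Primrec.fst)))) (Primrec.fst.comp Primrec.snd)
  refine ((h1.option_elim (o := fun p : (List (A × E) × List (A × E)) × ℕ => p.1.2[p.2]?)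
    (Primrec.list_getElem?.comp (Primrec.snd.comp Primrec.fst) Primrec.snd).to_comp 1).range_prod
    (Computable.list_length.comp Computable.snd)).congr fun π p => ?_
  rw [selfProb_eq]
  simp

variable [Fintype E]

theorem lowerApprox_contextProb {σ : Game n A E}
    (hσ : LowerSemicomputable fun x : List (Round n A E) × (Fin n → A) × (Fin n → E) =>
      σ x.1 x.2.1 x.2.2) (i : Fin n) :
    LowerApprox fun (π : Fin n → Strategy A E) l => contextProb σ π i l := by
  have hL : Primrec fun p : (List (Round n A E) × ℕ) × Round n A E => p.1.1.take p.1.2 :=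
    Primrec.list_take.comp (Primrec.snd.comp Primrec.fst) (Primrec.fst.comp Primrec.fst)
  have h1 : LowerApprox fun (π : Fin n → Strategy A E)
      (p : (List (Round n A E) × ℕ) × Round n A E) =>
      (∏ j ∈ Finset.univ.erase i, π j (playerHistory j (p.1.1.take p.1.2)) (p.2.1 j)) *
        σ (p.1.1.take p.1.2) p.2.1 p.2.2 := by
    refine LowerApprox.mul (LowerApprox.finset_prod _ fun j _ => ?_) ?_
    · exact LowerApprox.strategy j ((primrec_playerHistory j).comp hL)
        (Primrec.fin_app.comp (Primrec.fst.comp Primrec.snd) (Primrec.const j))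
    · exact (LowerSemicomputable.lowerApprox hσ fun x => (σ x.1 x.2.1).2.1 x.2.2).comp
        (Primrec.pair hL Primrec.snd).to_comp
  refine ((h1.option_elim (o := fun p : List (Round n A E) × ℕ => p.1[p.2]?)
    (Primrec.list_getElem?.comp Primrec.fst Primrec.snd).to_comp 1).range_prod
    Computable.list_length).congr fun π l => ?_
  rw [contextProb_eq]
  simp

theorem lowerApprox_one_sub [DecidableEq E] {ν : (Fin n → Strategy A E) → List (A × E) → ℝ}
    (hν : LowerApprox ν) (hc : ∀ π, IsContextual (ν π)) (hnil : ∀ π, ν π [] = 1) :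
    LowerApprox fun π h => 1 - ν π h := by
  have h1 : LowerApprox fun π (p : (List (A × E) × ℕ) × (A × E)) =>
      ∑ e, if e ≠ p.2.2 then ν π (p.1.1.take p.1.2 ++ [(p.2.1, e)]) else 0 := by
    refine LowerApprox.finset_sum _ fun e _ => LowerApprox.ite (hν.comp ?_) ?_
    · exact (primrec_append_singleton.comp (Primrec.list_take.comp (Primrec.snd.comp Primrec.fst)
        (Primrec.fst.comp Primrec.fst)) (Primrec.pair (Primrec.fst.comp Primrec.snd)
        (Primrec.const e))).to_comp
    · exact (Primrec.eq.comp (Primrec.const e) (Primrec.snd.comp Primrec.snd)).not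
  refine ((h1.option_elim (o := fun p : List (A × E) × ℕ => p.1[p.2]?)
    (Primrec.list_getElem?.comp Primrec.fst Primrec.snd).to_comp 0).range_sum
    Computable.list_length).congr fun π h => ?_
  rw [one_sub_contextual (hc π) (hnil π)]
  simp

variable {ρ : E → ℝ} {γ : ℕ → ℝ} {ν : (Fin n → Strategy A E) → List (A × E) → ℝ}

theorem lowerApprox_stageReward
    (hρ : LowerApprox fun (_ : Fin n → Strategy A E) e => ρ e)
    (hγ : LowerApprox fun (_ : Fin n → Strategy A E) t => γ t) (hν : LowerApprox ν) (i : Fin n) :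
    LowerApprox fun π h => stageReward ρ γ (ν π) (π i) h := by
  refine (hγ.comp Computable.list_length).mul (LowerApprox.finset_sum _ fun x _ => ?_)
  refine (LowerApprox.strategy i Primrec.id (Primrec.const x.1)).mul
    ((hρ.comp (Computable.const x.2)).mul (hν.comp ?_))
  exact (primrec_append_singleton.comp Primrec.id (Primrec.const x)).to_comp

theorem lowerApprox_futureValue
    (hρ : LowerApprox fun (_ : Fin n → Strategy A E) e => ρ e)
    (hρ' : ∀ e, ρ e ∈ Set.Icc (0 : ℝ) 1)
    (hγ : LowerApprox fun (_ : Fin n → Strategy A E) t => γ t)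
    (hγ' : ∀ t, 0 ≤ γ t) (hγs : Summable γ)
    (hν : LowerApprox ν) (hc : ∀ π, IsContextual (ν π)) (i : Fin n) :
    LowerApprox fun π h => futureValue ρ γ (ν π) (π i) h := by
  have h1 := (lowerApprox_selfProb i).mul ((lowerApprox_stageReward hρ hγ hν i).comp
    (u := fun p : List (A × E) × List (A × E) => p.1 ++ p.2) Primrec.list_append.to_comp)
  exact (h1.tsum fun π h => (hasSum_futureValue (hc π) hγ' hγs hρ' h).summable).congr
    fun π h => (hasSum_futureValue (hc π) hγ' hγs hρ' h).tsum_eq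

theorem lowerApprox_actionValue
    (hρ : LowerApprox fun (_ : Fin n → Strategy A E) e => ρ e)
    (hρ' : ∀ e, ρ e ∈ Set.Icc (0 : ℝ) 1)
    (hγ : LowerApprox fun (_ : Fin n → Strategy A E) t => γ t)
    (hγ' : ∀ t, 0 ≤ γ t) (hγs : Summable γ)
    (hν : LowerApprox ν) (hc : ∀ π, IsContextual (ν π)) (i : Fin n) :
    LowerApprox fun π (p : List (A × E) × A) => actionValue ρ γ (ν π) (π i) p.1 p.2 := by
  refine LowerApprox.finset_sum _ fun e _ => ?_
  have h1 : Computable fun p : List (A × E) × A => p.1 ++ [(p.2, e)] :=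
    (primrec_append_singleton.comp Primrec.fst
      (Primrec.pair Primrec.snd (Primrec.const e))).to_comp
  exact ((hγ.comp (Computable.list_length.comp Computable.fst)).mul
    ((hρ.comp (Computable.const e)).mul (hν.comp h1))).add
    ((lowerApprox_futureValue hρ hρ' hγ hγ' hγs hν hc i).comp h1)

/-- The difference of two action values, shifted by a constant to make it nonnegative. The negative
term is approximated through the complementary reward `1 - r`, the probabilities of the other
percept sequences and the estimable number `C - Γ`. -/
theorem lowerApprox_actionValue_sub [DecidableEq E] {r : E → ℝ} (hr : ∀ e, r e ∈ Set.Icc (0 : ℝ) 1)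
    (hrc : Estimable r) (hγ : ∀ k, 0 ≤ γ k) (hγs : Summable γ)
    (hΓ : Estimable (discountNorm γ)) {C : ℕ} (hC : discountNorm γ 0 ≤ C)
    (hν : LowerApprox ν) (hc : ∀ π, IsContextual (ν π)) (hnil : ∀ π, ν π [] = 1) (i : Fin n) :
    LowerApprox fun π (p : List (A × E) × A × A) =>
      C + actionValue r γ (ν π) (π i) p.1 p.2.1 - actionValue r γ (ν π) (π i) p.1 p.2.2 := by
  have hr' : ∀ e, 1 - r e ∈ Set.Icc (0 : ℝ) 1 := fun e =>
    ⟨sub_nonneg.2 (hr e).2, sub_le_self _ (hr e).1⟩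
  have hγe : Estimable γ := by
    have h := hΓ.sub (hΓ.comp Computable.succ)
    refine (funext fun t => ?_ : (fun t => discountNorm γ t - discountNorm γ t.succ) = γ) ▸ h
    rw [discountNorm_eq hγs t]
    exact add_sub_cancel_right _ _
  have hγl := Estimable.lowerApprox (A := A) (E := E) (n := n) hγe hγ
  have hrl := Estimable.lowerApprox (A := A) (E := E) (n := n) hrc fun e => (hr e).1
  have hrl' := Estimable.lowerApprox (A := A) (E := E) (n := n)
    (by simpa using (estimable_const 1).sub hrc) fun e => (hr' e).1
  have hΓl := Estimable.lowerApprox (A := A) (E := E) (n := n) hΓ (discountNorm_nonneg hγ)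
  have hCl := Estimable.lowerApprox (A := A) (E := E) (n := n) ((estimable_const C).sub hΓ)
    fun t => sub_nonneg.2 ((discountNorm_le_zero hγ hγs t).trans hC)
  have hlen : Computable fun p : List (A × E) × A × A => p.1.length :=
    Computable.list_length.comp Computable.fst
  have h1 := (lowerApprox_actionValue hrl hr hγl hγ hγs hν hc i).comp
    (u := fun p : List (A × E) × A × A => (p.1, p.2.1))
    (Computable.fst.pair (Computable.fst.comp Computable.snd))
  have h2 := (lowerApprox_actionValue hrl' hr' hγl hγ hγs hν hc i).comp
    (u := fun p : List (A × E) × A × A => (p.1, p.2.2))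
    (Computable.fst.pair (Computable.snd.comp Computable.snd))
  have h3 := (hΓl.comp hlen).mul ((lowerApprox_one_sub hν hc hnil).comp Computable.fst)
  refine ((h1.add h2).add (h3.add (hCl.comp hlen))).congr fun π p => ?_
  have h4 := actionValue_add_compl (π := π i) (hc π) hγ hγs hr p.1 p.2.2
  linear_combination h4

variable [DecidableEq A] [DecidableEq E]

theorem lowerApprox_subjectiveEnv {σ : Game n A E}
    (hσ : LowerSemicomputable fun x : List (Round n A E) × (Fin n → A) × (Fin n → E) =>
      σ x.1 x.2.1 x.2.2) (i : Fin n) :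
    LowerApprox fun (π : Fin n → Strategy A E) h => subjectiveEnv σ π i h := by
  have h1 := ((lowerApprox_contextProb hσ i).comp
    (u := fun p : List (A × E) × List (Round n A E) => p.2) Computable.snd).ite
    (p := fun p => playerHistory i p.2 = p.1)
    (Primrec.eq.comp ((primrec_playerHistory i).comp Primrec.snd) Primrec.fst)
  exact (h1.tsum fun π h => (hasSum_subjectiveEnv σ π i h).summable).congr fun π h =>
    (hasSum_subjectiveEnv σ π i h).tsum_eq

/-- It can be semidecided from answers about the strategies that one action of player `i` has a
larger value than another one. -/
theorem exists_comparison {r : E → ℝ} (hr : ∀ e, r e ∈ Set.Icc (0 : ℝ) 1)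
    (hrc : Estimable r) (hγ : ∀ k, 0 ≤ γ k) (hγs : Summable γ)
    (hΓ : Estimable (discountNorm γ)) {σ : Game n A E}
    (hσ : LowerSemicomputable fun x : List (Round n A E) × (Fin n → A) × (Fin n → E) =>
      σ x.1 x.2.1 x.2.2) :
    ∃ ev : Fin n × List (A × E) × A × A → List Bool → Bool, Computable₂ ev ∧
      ∀ (π : Fin n → Strategy A E) (i : Fin n) (h : List (A × E)) (a b : A),
        let Q := actionValue r γ (subjectiveEnv σ π i) (π i) h
        (∀ bs, CorrectAnswers π bs → ev (i, h, a, b) bs = true → Q b < Q a) ∧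
        (Q b < Q a → ∀ᶠ bs in answers π, ev (i, h, a, b) bs = true) := by
  obtain ⟨C, hC⟩ := exists_nat_ge (discountNorm γ 0)
  have h1 : ∀ i : Fin n, LowerApprox fun (π : Fin n → Strategy A E) (p : List (A × E) × A × A) =>
      C + actionValue r γ (subjectiveEnv σ π i) (π i) p.1 p.2.1 -
        actionValue r γ (subjectiveEnv σ π i) (π i) p.1 p.2.2 := fun i =>
    lowerApprox_actionValue_sub hr hrc hγ hγs hΓ hC (lowerApprox_subjectiveEnv hσ i)
      (fun π => isContextual_subjectiveEnv σ π i) (fun π => subjectiveEnv_nil σ π i) i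
  have h2 : LowerApprox fun (π : Fin n → Strategy A E) (p : Fin n × List (A × E) × A × A) =>
      C + actionValue r γ (subjectiveEnv σ π p.1) (π p.1) p.2.1 p.2.2.1 -
        actionValue r γ (subjectiveEnv σ π p.1) (π p.1) p.2.1 p.2.2.2 := by
    refine (LowerApprox.finset_sum Finset.univ fun i _ => ((h1 i).comp
      (u := fun p : Fin n × List (A × E) × A × A => p.2) Computable.snd).ite
      (p := fun p => p.1 = i) (Primrec.eq.comp Primrec.fst (Primrec.const i))).congr
      fun π p => ?_
    rw [Finset.sum_ite_eq]
    simp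
  obtain ⟨φ, hφ, h⟩ := h2
  have hfrac : ∀ z : ℕ × ℕ, C * (z.2 + 1) < z.1 ↔ (C : ℝ) < frac z := by
    intro z
    rw [frac, lt_div_iff₀ (by positivity)]
    exact_mod_cast Iff.rfl
  refine ⟨fun x bs => decide (C * ((φ x bs).2 + 1) < (φ x bs).1), ?_, fun π i h' a b => ⟨?_, ?_⟩⟩
  · have h3 : Primrec fun z : ℕ × ℕ => decide (C * (z.2 + 1) < z.1) :=
      primrecPred_iff_primrec_decide.1 (Primrec.nat_lt.comp (Primrec.nat_mul.comp
        (Primrec.const C) (Primrec.succ.comp Primrec.snd)) Primrec.fst)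
    exact h3.to_comp.comp hφ
  · intro bs hb hd
    have h4 := (hfrac _).1 (of_decide_eq_true hd)
    have h5 := (h π (i, h', a, b)).1 bs hb
    dsimp only at h5
    linarith
  · intro hlt
    have h4 := (h π (i, h', a, b)).2.eventually (lt_mem_nhds (a := (C : ℝ))
      (by dsimp only; linarith))
    filter_upwards [h4] with bs h5
    exact decide_eq_true ((hfrac _).2 h5)

end ActionValues

/-! ### Machines which know their own programs -/

section Machines

variable {A E : Type*} [Primcodable A] [Primcodable E]

/-- A function `act` on pairs, transported to codes; it is `0` on numbers which code no pair. -/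
def onCodes {C M X Y : Type*} [Primcodable M] [Primcodable X] [Primcodable Y]
    (act : C → M → X → Y) (c : C) (v : ℕ) : ℕ :=
  ((Encodable.decode (α := M) v.unpair.1).bind fun m =>
    (Encodable.decode (α := X) v.unpair.2).map fun w => Encodable.encode (act c m w)).getD 0

theorem computable_onCodes {C M X Y : Type*} [Primcodable C] [Primcodable M] [Primcodable X]
    [Primcodable Y] {act : C → M → X → Y}
    (hact : Computable fun p : (C × M) × X => act p.1.1 p.1.2 p.2) : Computable₂ (onCodes act) := by
  have h1 : Computable fun p : C × ℕ => Encodable.decode (α := M) p.2.unpair.1 :=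
    Computable.decode.comp (Computable.fst.comp (Computable.unpair.comp Computable.snd))
  have h2 : Computable fun p : (C × ℕ) × M => p.1.2.unpair.2 :=
    Computable.snd.comp (Computable.unpair.comp (Computable.snd.comp Computable.fst))
  have h3 : Computable fun p : (C × ℕ) × M => Encodable.decode (α := X) p.1.2.unpair.2 :=
    Computable.decode.comp h2
  have h4 : Computable fun p : ((C × ℕ) × M) × X => ((p.1.1.1, p.1.2), p.2) :=
    ((Computable.fst.comp (Computable.fst.comp Computable.fst)).pair
      (Computable.snd.comp Computable.fst)).pair Computable.snd
  have h5 : Computable fun p : ((C × ℕ) × M) × X => act p.1.1.1 p.1.2 p.2 :=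
    Computable.comp (f := fun p : (C × M) × X => act p.1.1 p.1.2 p.2)
      (g := fun p : ((C × ℕ) × M) × X => ((p.1.1.1, p.1.2), p.2)) hact h4
  have h6 := Computable.option_map h3 (Computable.encode.comp h5).to₂
  exact Computable.option_getD (Computable.option_bind h1 h6.to₂) (Computable.const 0)

/-- Kleene's recursion theorem for families of programs: the programs indexed by `m : M` may all
make use of their own and each others' codes, which are the codes `c.curry m`. -/
theorem exists_code_eval_curry {M X Y : Type*} [Primcodable M] [Primcodable X] [Primcodable Y]
    (act : Nat.Partrec.Code → M → X → Y)
    (hact : Computable fun p : (Nat.Partrec.Code × M) × X => act p.1.1 p.1.2 p.2) :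
    ∃ c : Nat.Partrec.Code, ∀ (m : M) (x : X),
      (c.curry (Encodable.encode m)).eval (Encodable.encode x) =
        Part.some (Encodable.encode (act c m x)) := by
  obtain ⟨c, hc⟩ := Nat.Partrec.Code.fixed_point₂
    (f := fun c v => Part.some (onCodes act c v)) (computable_onCodes hact).partrec₂
  refine ⟨c, fun m x => ?_⟩
  rw [Nat.Partrec.Code.eval_curry, hc]
  simp [onCodes]

/-- Machines which know their own and each others' programs. -/
theorem exists_machine {M : Type*} [Primcodable M]
    (act : Machine → M → List (A ⊕ E) × List Bool → Action A E)
    (hact : Computable fun p : (Machine × M) × (List (A ⊕ E) × List Bool) =>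
      act p.1.1 p.1.2 p.2) :
    ∃ c : Machine, ∀ (m : M) (x : List (A ⊕ E)) (bs : List Bool),
      Machine.next (Nat.Partrec.Code.curry c (Encodable.encode m)) x bs =
        some (act c m (x, bs)) := by
  obtain ⟨c, hc⟩ := exists_code_eval_curry act hact
  refine ⟨c, fun m x bs => ?_⟩
  classical
  rw [Machine.next, Part.toOption_eq_some_iff.2 (Part.eq_some_iff.1 (hc m (x, bs))),
    Option.bind_some]
  exact Encodable.encodek _

theorem outProb_eq_of_haltProb {O : Oracle A E} {T : Machine} {x : List (A ⊕ E)} {α : A} {v : ℝ}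
    (K : ℕ) (h : ∀ k, K < k → haltProb O T x [Sum.inl α] k [] = v) : outProb O T x α = v := by
  refine tendsto_nhds_unique (tendsto_atTop_ciSup (haltProb_mono O T x _ []) ?_)
    (tendsto_atTop_of_eventually_const (i₀ := K + 1) fun k hk => h k hk)
  exact ⟨1, by rintro _ ⟨k, rfl⟩; exact (haltProb_mem_Icc O T x _ k []).2⟩

theorem outProb_nonneg (O : Oracle A E) (T : Machine) (x : List (A ⊕ E)) (α : A) :
    0 ≤ outProb O T x α :=
  Real.iSup_nonneg fun k => (haltProb_mem_Icc O T x _ k []).1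

variable [Fintype A] [DecidableEq A]

/-- A reflective oracle compares the output probabilities of a machine which halts with
probability `1` to rational numbers. -/
theorem Oracle.IsReflective.answer {O : Oracle A E} (hO : O.IsReflective) {T : Machine}
    {x : List (A ⊕ E)} (hT : ∑ α, outProb O T x α = 1) (p : Set.Icc (0 : ℚ) 1) (α : A) :
    (((p : ℚ) : ℝ) < outProb O T x α → (O T x p α : ℝ) = 1) ∧
      (outProb O T x α < ((p : ℚ) : ℝ) → (O T x p α : ℝ) = 0) := by
  obtain ⟨q, hq, h⟩ := hO T x
  have h1 := (Finset.sum_eq_sum_iff_of_le fun α _ => (h α).1).1 (hT.trans hq.symm) α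
    (Finset.mem_univ _)
  rw [h1]
  exact (h α).2.2 p

/-- If a machine halts surely with one of two symbols `a` and `b`, a reflective oracle tells with
which one. -/
theorem Oracle.IsReflective.answer_half {O : Oracle A E} (hO : O.IsReflective) {T : Machine}
    {x : List (A ⊕ E)} {a : A} :
    (outProb O T x a = 1 → (O T x (queryRat (1, 1)) a : ℝ) = 1) ∧
      ∀ b, b ≠ a → outProb O T x b = 1 → (O T x (queryRat (1, 1)) a : ℝ) = 0 := by
  have hp : ((queryRat (1, 1) : ℚ) : ℝ) = 1 / 2 := by norm_num [queryRat]
  obtain ⟨q, -, h⟩ := hO T x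
  obtain ⟨h1, h2, h3⟩ := h a
  constructor
  · intro ha
    exact (h3 _).1 (by rw [hp]; linarith)
  · intro b hb hb1
    have h4 : outProb O T x b ≤ ∑ β ∈ Finset.univ.erase a, outProb O T x β :=
      Finset.single_le_sum (f := fun β => outProb O T x β)
        (fun β _ => outProb_nonneg O T x β) (Finset.mem_erase.2 ⟨hb, Finset.mem_univ _⟩)
    exact (h3 _).2 (by rw [hp]; linarith)

end Machines

/-! ### Tournaments -/

section Tournament

variable {A E : Type*}

/-- One duel between the champion and the first one of the remaining challengers; the champion wins
on `true`. -/
def duelStep (s : A × List A) (b : Bool) : A × List A :=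
  s.2.head?.elim s fun d => (bif b then s.1 else d, s.2.tail)

/-- Champion and remaining challengers after the duels with the results `bs`. -/
def duelState (s : A × List A) (bs : List Bool) : A × List A := bs.foldl duelStep s

/-- The distribution of the winner, if `o a d` is the probability that the champion `a` beats the
challenger `d`. -/
def winProb (o : A → A → ℝ) [DecidableEq A] : A → List A → A → ℝ
  | a, [], α => if a = α then 1 else 0
  | a, d :: l, α => o a d * winProb o a l α + (1 - o a d) * winProb o d l α

theorem duelState_append (s : A × List A) (bs : List Bool) (b : Bool) :
    duelState s (bs ++ [b]) = duelStep (duelState s bs) b := by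
  simp [duelState]

theorem primrec_duelState [Primcodable A] (s : A × List A) : Primrec (duelState s) := by
  have h1 : Primrec₂ (duelStep : A × List A → Bool → A × List A) := by
    refine (Primrec.option_casesOn (o := fun p : (A × List A) × Bool => p.1.2.head?)
      (f := fun p => p.1) (g := fun p d => (bif p.2 then p.1.1 else d, p.1.2.tail))
      (Primrec.list_head?.comp (Primrec.snd.comp Primrec.fst)) Primrec.fst ?_).of_eq fun p => ?_
    · exact Primrec.pair (Primrec.cond (Primrec.snd.comp Primrec.fst)
        (Primrec.fst.comp (Primrec.fst.comp Primrec.fst)) Primrec.snd)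
        (Primrec.list_tail.comp (Primrec.snd.comp (Primrec.fst.comp Primrec.fst)))
    · simp only [duelStep]
      cases p.1.2.head? <;> rfl
  exact Primrec.list_foldl Primrec.id (Primrec.const s)
    (h1.comp (Primrec.fst.comp Primrec.snd) (Primrec.snd.comp Primrec.snd)).to₂

variable [DecidableEq A]

theorem sum_winProb [Fintype A] (o : A → A → ℝ) (a : A) (l : List A) :
    ∑ α, winProb o a l α = 1 := by
  induction l generalizing a with
  | nil => simp [winProb]
  | cons d l ih =>
    simp only [winProb]
    rw [Finset.sum_add_distrib, ← Finset.mul_sum, ← Finset.mul_sum, ih, ih]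
    ring

/-- If the better one always wins a duel, the winner of the tournament is the best one. -/
theorem le_of_winProb_ne_zero {o : A → A → ℝ} {Q : A → ℝ} {a : A} {l : List A}
    (hl : (a :: l).Nodup)
    (ho : ∀ a d, a ≠ d → (Q d < Q a → o a d = 1) ∧ (Q a < Q d → o a d = 0))
    {α : A} (hα : winProb o a l α ≠ 0) : ∀ b ∈ a :: l, Q b ≤ Q α := by
  induction l generalizing a with
  | nil =>
    rw [winProb] at hα
    have : a = α := by
      by_contra h
      exact hα (if_neg h)
    simp [this]
  | cons d l ih =>
    simp only [List.nodup_cons, List.mem_cons, not_or] at hl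
    obtain ⟨⟨had, hal⟩, hdl, hl⟩ := hl
    rw [winProb] at hα
    rcases ne_or_eq (o a d * winProb o a l α) 0 with h | h
    · have h1 := ih (by simp [hal, hl]) (right_ne_zero_of_mul h)
      have h2 : Q d ≤ Q a := not_lt.1 fun h' => left_ne_zero_of_mul h ((ho a d had).2 h')
      intro b hb
      rcases List.mem_cons.1 hb with rfl | hb
      · exact h1 _ List.mem_cons_self
      rcases List.mem_cons.1 hb with rfl | hb
      · exact h2.trans (h1 _ List.mem_cons_self)
      · exact h1 _ (List.mem_cons_of_mem _ hb)
    · rw [h, zero_add] at hα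
      have h1 := ih (by simp [hdl, hl]) (right_ne_zero_of_mul hα)
      have h2 : Q a ≤ Q d := not_lt.1 fun h' => left_ne_zero_of_mul hα (by
        rw [(ho a d had).1 h', sub_self])
      intro b hb
      rcases List.mem_cons.1 hb with rfl | hb
      · exact h2.trans (h1 _ List.mem_cons_self)
      · exact h1 _ hb

variable [Primcodable A] [Primcodable E]

/-- What a machine does next which lets the oracle decide the duels, where the duel of `a` and `d`
is about the machine `N a d`. -/
def duelAction (N : A → A → Machine) (x : List (A ⊕ E)) (s : A × List A) : Action A E :=
  s.2.head?.elim (Sum.inr (Sum.inr [Sum.inl s.1])) fun d =>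
    Sum.inr (Sum.inl (N s.1 d, x, (1, 1), s.1))

/-- The answers in a tournament are independent, so its winner has the distribution `winProb`. -/
theorem outProb_duel (O : Oracle A E) {T : Machine} {N : A → A → Machine} {x : List (A ⊕ E)} {a : A}
    {l : List A} (hT : ∀ bs, T.next x bs = some (duelAction N x (duelState (a, l) bs))) (α : A) :
    outProb O T x α = winProb (fun a d => (O (N a d) x (queryRat (1, 1)) a : ℝ)) a l α := by
  have h1 : ∀ (r : List A) (c : A) (bs : List Bool) (k : ℕ), duelState (a, l) bs = (c, r) →
      r.length < k → haltProb O T x [Sum.inl α] k bs =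
        winProb (fun a d => (O (N a d) x (queryRat (1, 1)) a : ℝ)) c r α := by
    intro r
    induction r with
    | nil =>
      intro c bs k hs hk
      obtain ⟨k, rfl⟩ := Nat.exists_eq_succ_of_ne_zero (Nat.ne_of_gt hk)
      rw [haltProb, hT, hs]
      simp [duelAction, winProb]
    | cons d r ih =>
      intro c bs k hs hk
      obtain ⟨k, rfl⟩ := Nat.exists_eq_succ_of_ne_zero (Nat.ne_of_gt (Nat.zero_lt_of_lt hk))
      have hk' : r.length < k := by simpa using hk
      have ht := ih c (bs ++ [true]) k (by rw [duelState_append, hs]; rfl) hk'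
      have hf := ih d (bs ++ [false]) k (by rw [duelState_append, hs]; rfl) hk'
      rw [haltProb, hT, hs]
      simp only [duelAction, List.head?_cons, Option.elim_some, ht, hf, winProb]
  exact outProb_eq_of_haltProb l.length fun k hk => h1 l a [] k rfl hk

end Tournament

/-! ### Searching for evidence -/

section Search

variable {A E : Type*} [Primcodable A] [Primcodable E] [Fintype A] {n : ℕ}

theorem CorrectAnswers.append {π : Fin n → Strategy A E} {bs : List Bool}
    (h : CorrectAnswers π bs) {b : Bool}
    (hb : ∀ q : Question n A E, Encodable.decode bs.length = some q →
      (b = true → ((queryRat q.2.2.1 : ℚ) : ℝ) ≤ π q.1 q.2.1 q.2.2.2) ∧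
      (b = false → π q.1 q.2.1 q.2.2.2 ≤ ((queryRat q.2.2.1 : ℚ) : ℝ))) :
    CorrectAnswers π (bs ++ [b]) := by
  intro s q b' hs hb'
  rcases lt_trichotomy s bs.length with hlt | rfl | hgt
  · rw [List.getElem?_append_left hlt] at hb'
    exact h s q b' hs hb'
  · have : b = b' := by simpa using hb'
    exact this ▸ hb q hs
  · rw [List.getElem?_eq_none (by simp; omega)] at hb'
    simp at hb'

/-- Ask question number `s`, where player `j` is represented by the machine `T j`; if there is none,
read a random bit to leave the position empty. -/
def askAction (T : Fin n → Machine) (s : ℕ) : Action A E :=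
  (Encodable.decode (α := Question n A E) s).elim (Sum.inl ()) fun q =>
    Sum.inr (Sum.inl (T q.1, historyString q.2.1, q.2.2.1, q.2.2.2))

variable [DecidableEq A]

/-- A machine which, as long as the answers are correct, asks one question after the other until it
halts with output `w`, at the latest after `s` answers, halts with output `w` surely: incorrect
answers have probability `0`. -/
theorem haltProb_search {O : Oracle A E} (hO : O.IsReflective) {π : Fin n → Strategy A E}
    {T : Fin n → Machine}
    (hT : ∀ j (h : List (A × E)) α, π j h α = outProb O (T j) (historyString h) α) {N : Machine}
    {x w : List (A ⊕ E)} {s : ℕ}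
    (hN : ∀ bs, CorrectAnswers π bs → N.next x bs = some (Sum.inr (Sum.inr w)) ∨
      bs.length < s ∧ N.next x bs = some (askAction T bs.length))
    {k : ℕ} {bs : List Bool} (hbs : CorrectAnswers π bs) (hk : s < k + bs.length) (hk0 : 0 < k) :
    haltProb O N x w k bs = 1 := by
  induction k generalizing bs with
  | zero => omega
  | succ k ih =>
    rcases hN bs hbs with h | ⟨hs, h⟩
    · rw [haltProb, h]
      simp
    have hk' : 0 < k := by omega
    have next : ∀ b, CorrectAnswers π (bs ++ [b]) → haltProb O N x w k (bs ++ [b]) = 1 :=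
      fun b hb => ih hb (by simp; omega) hk'
    rw [haltProb, h, askAction]
    cases hd : Encodable.decode (α := Question n A E) bs.length with
    | none =>
      have h1 : ∀ b, CorrectAnswers π (bs ++ [b]) := fun b => hbs.append (by simp [hd])
      simp only [Option.elim_none]
      rw [next _ (h1 true), next _ (h1 false)]
      norm_num
    | some q =>
      simp only [Option.elim_some]
      have hsum : ∑ α, outProb O (T q.1) (historyString q.2.1) α = 1 := by
        simp only [← hT]
        exact (π q.1 q.2.1).2.2
      obtain ⟨h1, h2⟩ := hO.answer hsum (queryRat q.2.2.1) q.2.2.2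
      rw [← hT] at h1 h2
      generalize (O (T q.1) (historyString q.2.1) (queryRat q.2.2.1) q.2.2.2 : ℝ) = o at h1 h2 ⊢
      have htrue : o ≠ 0 → haltProb O N x w k (bs ++ [true]) = 1 := fun ho =>
        next _ (hbs.append (by
          rw [hd]
          rintro q' ⟨⟩
          exact ⟨fun _ => not_lt.1 fun h' => ho (h2 h'), by simp⟩))
      have hfalse : 1 - o ≠ 0 → haltProb O N x w k (bs ++ [false]) = 1 := fun ho =>
        next _ (hbs.append (by
          rw [hd]
          rintro q' ⟨⟩
          exact ⟨by simp, fun _ => not_lt.1 fun h' => ho (by rw [h1 h', sub_self])⟩))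
      rcases eq_or_ne o 0 with rfl | ho
      · rw [hfalse (by norm_num)]; ring
      rcases eq_or_ne (1 - o) 0 with ho' | ho'
      · rw [htrue ho, ho']
        linarith
      · rw [htrue ho, hfalse ho']; ring

end Search

/-! ### Reading the input -/

section Parse

variable {A E : Type*}

/-- The history represented by a string, read symbol by symbol; the action is kept until the percept
comes. -/
def parseHistory (x : List (A ⊕ E)) : List (A × E) :=
  (x.foldl (fun (s : Option A × List (A × E)) c => Sum.casesOn (motive := fun _ => _) c
    (fun a => (some a, s.2)) fun e => (none, s.1.elim s.2 fun a => s.2 ++ [(a, e)])) (none, [])).2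

theorem parseHistory_historyString (h : List (A × E)) : parseHistory (historyString h) = h := by
  suffices H : (historyString h).foldl (fun (s : Option A × List (A × E)) c =>
      Sum.casesOn (motive := fun _ => _) c
      (fun a => (some a, s.2)) fun e => (none, s.1.elim s.2 fun a => s.2 ++ [(a, e)])) (none, []) =
      (none, h) by
    rw [parseHistory, H]
  induction h using List.reverseRecOn with
  | nil => rfl
  | append_singleton h x ih =>
    have h1 : historyString (h ++ [x]) = historyString h ++ [Sum.inl x.1, Sum.inr x.2] := by
      simp [historyString]
    rw [h1, List.foldl_append, ih]
    rfl

variable [Primcodable A] [Primcodable E]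

theorem primrec_parseHistory : Primrec (parseHistory : List (A ⊕ E) → List (A × E)) := by
  refine Primrec.snd.comp (Primrec.list_foldl (f := fun x : List (A ⊕ E) => x)
    (h := fun _ (p : (Option A × List (A × E)) × (A ⊕ E)) => Sum.casesOn (motive := fun _ => _) p.2
      (fun a => (some a, p.1.2)) fun e => (none, p.1.1.elim p.1.2 fun a => p.1.2 ++ [(a, e)]))
    Primrec.id (Primrec.const (none, [])) ?_)
  refine Primrec.sumCasesOn (Primrec.snd.comp Primrec.snd) ?_ ?_
  · exact Primrec.pair (Primrec.option_some.comp Primrec.snd)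
      (Primrec.snd.comp (Primrec.fst.comp (Primrec.snd.comp Primrec.fst)))
  · refine Primrec.pair (Primrec.const none) ?_
    refine (Primrec.option_casesOn
      (o := fun p : (List (A ⊕ E) × ((Option A × List (A × E)) × (A ⊕ E))) × E => p.1.2.1.1)
      (f := fun p => p.1.2.1.2) (g := fun p a => p.1.2.1.2 ++ [(a, p.2)])
      (Primrec.fst.comp (Primrec.fst.comp (Primrec.snd.comp Primrec.fst)))
      (Primrec.snd.comp (Primrec.fst.comp (Primrec.snd.comp Primrec.fst))) ?_).of_eq fun p => ?_
    · exact Primrec.list_concat.comp (Primrec.snd.comp (Primrec.fst.comp (Primrec.snd.comp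
        (Primrec.fst.comp Primrec.fst)))) (Primrec.pair Primrec.snd
          (Primrec.snd.comp Primrec.fst))
    · cases p.1.2.1.1 <;> rfl

theorem primrec_historyString : Primrec (historyString : List (A × E) → List (A ⊕ E)) :=
  Primrec.list_flatMap Primrec.id (Primrec.list_cons.comp
    (Primrec.sumInl.comp (Primrec.fst.comp Primrec.snd)) (Primrec.list_cons.comp
      (Primrec.sumInr.comp (Primrec.snd.comp Primrec.snd)) (Primrec.const []))).to₂

end Parse

/-! ### The players -/

section Players

variable {A E : Type*} [Primcodable A] [Primcodable E] {n : ℕ}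

/-- The machines of the equilibrium, given the program `c` from which all of them are obtained by
`curry`. Machine `inl i` is player `i`: it finds the best action in a tournament. Machine
`inr (i, a, b)` decides the duel of the actions `a` and `b` of player `i`: it asks the oracle about
all players until the answers prove that one of the actions is better. -/
def playerAction (ev : Fin n × List (A × E) × A × A → List Bool → Bool) (s : A × List A)
    (c : Machine) (m : Fin n ⊕ Fin n × A × A) (w : List (A ⊕ E) × List Bool) : Action A E :=
  Sum.casesOn (motive := fun _ => _) m
    (fun i => duelAction (fun a b => c.curry (Encodable.encode
      (Sum.inr (i, a, b) : Fin n ⊕ Fin n × A × A))) w.1 (duelState s w.2))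
    fun t =>
      bif ev (t.1, parseHistory w.1, t.2.1, t.2.2) w.2 then Sum.inr (Sum.inr [Sum.inl t.2.1]) else
      bif ev (t.1, parseHistory w.1, t.2.2, t.2.1) w.2 then Sum.inr (Sum.inr [Sum.inl t.2.2]) else
      askAction (fun j => c.curry (Encodable.encode (Sum.inl j : Fin n ⊕ Fin n × A × A)))
        w.2.length

theorem computable_playerAction {ev : Fin n × List (A × E) × A × A → List Bool → Bool}
    (hev : Computable₂ ev) (s : A × List A) :
    Computable fun p : (Machine × (Fin n ⊕ Fin n × A × A)) × (List (A ⊕ E) × List Bool) =>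
      playerAction ev s p.1.1 p.1.2 p.2 := by
  refine Computable.sumCasesOn (Computable.snd.comp Computable.fst) ?_ ?_
  · have hs : Primrec fun p : ((Machine × (Fin n ⊕ Fin n × A × A)) ×
        (List (A ⊕ E) × List Bool)) × Fin n => duelState s p.1.2.2 :=
      (primrec_duelState s).comp (Primrec.snd.comp (Primrec.snd.comp Primrec.fst))
    refine ((Primrec.option_casesOn
      (f := fun p => Sum.inr (Sum.inr [Sum.inl (duelState s p.1.2.2).1]))
      (g := fun p d => Sum.inr (Sum.inl (Nat.Partrec.Code.curry p.1.1.1 (Encodable.encode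
        (Sum.inr (p.2, (duelState s p.1.2.2).1, d) : Fin n ⊕ Fin n × A × A)), p.1.2.1, (1, 1),
        (duelState s p.1.2.2).1)))
      (Primrec.list_head?.comp (Primrec.snd.comp hs)) ?_ ?_).of_eq fun p => ?_).to_comp
    · exact Primrec.sumInr.comp (Primrec.sumInr.comp (Primrec.list_cons.comp
        (Primrec.sumInl.comp (Primrec.fst.comp hs)) (Primrec.const [])))
    · have h1 : Primrec fun p : (((Machine × (Fin n ⊕ Fin n × A × A)) ×
          (List (A ⊕ E) × List Bool)) × Fin n) × A => (duelState s p.1.1.2.2).1 :=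
        Primrec.fst.comp (hs.comp Primrec.fst)
      refine Primrec.sumInr.comp (Primrec.sumInl.comp (Primrec.pair ?_ (Primrec.pair
        (Primrec.fst.comp (Primrec.snd.comp (Primrec.fst.comp Primrec.fst)))
        (Primrec.pair (Primrec.const (1, 1)) h1))))
      exact Nat.Partrec.Code.primrec₂_curry.comp (Primrec.fst.comp (Primrec.fst.comp
        (Primrec.fst.comp Primrec.fst))) (Primrec.encode.comp (Primrec.sumInr.comp
        (Primrec.pair (Primrec.snd.comp Primrec.fst) (Primrec.pair h1 Primrec.snd))))
    · simp only [duelAction]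
      cases (duelState s p.1.2.2).2.head? <;> rfl
  · have hx : Computable fun p : ((Machine × (Fin n ⊕ Fin n × A × A)) ×
        (List (A ⊕ E) × List Bool)) × (Fin n × A × A) => parseHistory p.1.2.1 :=
      primrec_parseHistory.to_comp.comp
        (Computable.fst.comp (Computable.snd.comp Computable.fst))
    have hb : Computable fun p : ((Machine × (Fin n ⊕ Fin n × A × A)) ×
        (List (A ⊕ E) × List Bool)) × (Fin n × A × A) => p.1.2.2 :=
      Computable.snd.comp (Computable.snd.comp Computable.fst)
    have ha1 : Computable fun p : ((Machine × (Fin n ⊕ Fin n × A × A)) ×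
        (List (A ⊕ E) × List Bool)) × (Fin n × A × A) => p.2.2.1 :=
      Computable.fst.comp (Computable.snd.comp Computable.snd)
    have ha2 : Computable fun p : ((Machine × (Fin n ⊕ Fin n × A × A)) ×
        (List (A ⊕ E) × List Bool)) × (Fin n × A × A) => p.2.2.2 :=
      Computable.snd.comp (Computable.snd.comp Computable.snd)
    have hi : Computable fun p : ((Machine × (Fin n ⊕ Fin n × A × A)) ×
        (List (A ⊕ E) × List Bool)) × (Fin n × A × A) => p.2.1 :=
      Computable.fst.comp Computable.snd
    have hw : Primrec fun a : A => (Sum.inr (Sum.inr [Sum.inl a]) : Action A E) :=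
      Primrec.sumInr.comp (Primrec.sumInr.comp (Primrec.list_cons.comp Primrec.sumInl
        (Primrec.const [])))
    refine Computable.cond (hev.comp (hi.pair (hx.pair (ha1.pair ha2))) hb)
      (hw.to_comp.comp ha1) (Computable.cond (hev.comp (hi.pair (hx.pair (ha2.pair ha1))) hb)
      (hw.to_comp.comp ha2) ?_)
    refine ((Primrec.option_casesOn
      (o := fun p : ((Machine × (Fin n ⊕ Fin n × A × A)) ×
        (List (A ⊕ E) × List Bool)) × (Fin n × A × A) =>
          Encodable.decode (α := Question n A E) p.1.2.2.length)
      (f := fun p => Sum.inl ())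
      (g := fun p q => Sum.inr (Sum.inl (Nat.Partrec.Code.curry p.1.1.1 (Encodable.encode
        (Sum.inl q.1 : Fin n ⊕ Fin n × A × A)), historyString q.2.1, q.2.2.1, q.2.2.2)))
      (Primrec.decode.comp (Primrec.list_length.comp (Primrec.snd.comp (Primrec.snd.comp
        Primrec.fst)))) (Primrec.const _) ?_).of_eq fun p => ?_).to_comp
    · refine Primrec.sumInr.comp (Primrec.sumInl.comp (Primrec.pair ?_ (Primrec.pair
        (primrec_historyString.comp (Primrec.fst.comp (Primrec.snd.comp Primrec.snd)))
        (Primrec.snd.comp (Primrec.snd.comp Primrec.snd)))))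
      exact Nat.Partrec.Code.primrec₂_curry.comp (Primrec.fst.comp (Primrec.fst.comp
        (Primrec.fst.comp Primrec.fst))) (Primrec.encode.comp (Primrec.sumInl.comp
        (Primrec.fst.comp Primrec.snd)))
    · simp only [askAction]
      cases Encodable.decode (α := Question n A E) p.1.2.2.length <;> rfl

variable [Fintype A] [DecidableEq A]

/-- If it can be semidecided from correct answers about the strategies of the players which one of
two actions has a larger value `Q`, there are oracle computable strategies which only choose actions
of maximal value. The values may depend on these strategies themselves. -/
theorem exists_greedy_strategies {O : Oracle A E} (hO : O.IsReflective)
    (Q : (Fin n → Strategy A E) → Fin n → List (A × E) → A → ℝ)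
    {ev : Fin n × List (A × E) × A × A → List Bool → Bool} (hev : Computable₂ ev)
    (hsound : ∀ (π : Fin n → Strategy A E) i h a b bs, CorrectAnswers π bs →
      ev (i, h, a, b) bs = true → Q π i h b < Q π i h a)
    (hcomplete : ∀ (π : Fin n → Strategy A E) i h a b, Q π i h b < Q π i h a →
      ∀ᶠ bs in answers π, ev (i, h, a, b) bs = true) :
    ∃ π : Fin n → Strategy A E, (∀ i, (π i).IsOracleComputable O) ∧
      ∀ i h a, π i h a ≠ 0 → ∀ b, Q π i h b ≤ Q π i h a := by
  -- a list of all actions; there are some, since the oracle is reflective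
  obtain ⟨a₀, l, hl⟩ : ∃ a₀ l, (Finset.univ : Finset A).toList = a₀ :: l := by
    refine List.exists_cons_of_ne_nil fun h => ?_
    obtain ⟨q, hq, -⟩ := hO Nat.Partrec.Code.zero []
    rw [Finset.toList_eq_nil.1 h] at hq
    simp at hq
  obtain ⟨c, hc⟩ := exists_machine _ (computable_playerAction hev (a₀, l))
  let T : Fin n → Machine := fun i =>
    c.curry (Encodable.encode (Sum.inl i : Fin n ⊕ Fin n × A × A))
  let N : Fin n → A → A → Machine := fun i a b =>
    c.curry (Encodable.encode (Sum.inr (i, a, b) : Fin n ⊕ Fin n × A × A))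
  have hT : ∀ i x α, outProb O (T i) x α =
      winProb (fun a b => (O (N i a b) x (queryRat (1, 1)) a : ℝ)) a₀ l α := fun i x α =>
    outProb_duel O (N := N i) (fun bs => hc (Sum.inl i) x bs) α
  -- the players' machines halt surely, whatever the oracle answers
  let π : Fin n → Strategy A E := fun i h => ⟨fun a => outProb O (T i) (historyString h) a,
    fun a => outProb_nonneg O (T i) _ a, by simp only [hT]; exact sum_winProb _ _ _⟩
  have hπ : ∀ i (h : List (A × E)) α, π i h α = outProb O (T i) (historyString h) α :=
    fun i h α => rfl
  -- the machine of a duel halts surely with the better action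
  have key : ∀ i h a b, (Q π i h b < Q π i h a → outProb O (N i a b) (historyString h) a = 1) ∧
      (Q π i h a < Q π i h b → outProb O (N i a b) (historyString h) b = 1) := by
    intro i h a b
    have hnext : ∀ bs, (N i a b).next (historyString h) bs =
        some (bif ev (i, h, a, b) bs then Sum.inr (Sum.inr [Sum.inl a]) else
          bif ev (i, h, b, a) bs then Sum.inr (Sum.inr [Sum.inl b]) else
            askAction T bs.length) := by
      intro bs
      refine (hc (Sum.inr (i, a, b)) (historyString h) bs).trans ?_
      simp only [playerAction, parseHistory_historyString]
      rfl
    constructor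
    · intro hlt
      obtain ⟨s, hs⟩ := (eventually_answers_iff π).1 (hcomplete π i h a b hlt)
      refine outProb_eq_of_haltProb s fun k hk => haltProb_search hO hπ (s := s) (fun bs hbs => ?_)
        (correctAnswers_nil π) (by simpa using hk) (by omega)
      have h2 : ev (i, h, b, a) bs = false := Bool.eq_false_iff.2 fun h' =>
        lt_asymm hlt (hsound π i h b a bs hbs h')
      rw [hnext, h2]
      cases h1 : ev (i, h, a, b) bs
      · refine Or.inr ⟨lt_of_not_ge fun hge => ?_, rfl⟩
        exact absurd (hs bs hge hbs) (by simp [h1])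
      · exact Or.inl rfl
    · intro hlt
      obtain ⟨s, hs⟩ := (eventually_answers_iff π).1 (hcomplete π i h b a hlt)
      refine outProb_eq_of_haltProb s fun k hk => haltProb_search hO hπ (s := s) (fun bs hbs => ?_)
        (correctAnswers_nil π) (by simpa using hk) (by omega)
      have h2 : ev (i, h, a, b) bs = false := Bool.eq_false_iff.2 fun h' =>
        lt_asymm hlt (hsound π i h a b bs hbs h')
      rw [hnext, h2]
      cases h1 : ev (i, h, b, a) bs
      · refine Or.inr ⟨lt_of_not_ge fun hge => ?_, rfl⟩
        exact absurd (hs bs hge hbs) (by simp [h1])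
      · exact Or.inl rfl
  refine ⟨π, fun i => ⟨T i, hπ i⟩, fun i h a ha b => ?_⟩
  rw [hπ, hT] at ha
  refine le_of_winProb_ne_zero (hl ▸ Finset.nodup_toList _) (fun a d had => ?_) ha b
    (hl ▸ Finset.mem_toList.2 (Finset.mem_univ b))
  exact ⟨fun hlt => hO.answer_half.1 ((key i h a d).1 hlt),
    fun hlt => hO.answer_half.2 d had.symm ((key i h a d).2 hlt)⟩

end Players

end

end ReflOracle

theorem mainTheorem4 {A E : Type*} [Fintype A] [DecidableEq A] [Primcodable A]
    [Fintype E] [DecidableEq E] [Primcodable E]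
    (O : ReflOracle.Oracle A E) (hO : O.IsReflective)
    (r : E → ℝ) (hr : ∀ e, r e ∈ Set.Icc (0 : ℝ) 1) (hrc : ReflOracle.Estimable r)
    (γ : ℕ → ℝ) (hγ : ∀ k, 0 ≤ γ k) (hγs : Summable γ)
    (hΓ : ReflOracle.Estimable (ReflOracle.discountNorm γ))
    (n : ℕ) (σ : ReflOracle.Game n A E)
    (hσ : ReflOracle.LowerSemicomputable
      fun x : List (ReflOracle.Round n A E) × (Fin n → A) × (Fin n → E) => σ x.1 x.2.1 x.2.2) :
    ∃ π : Fin n → ReflOracle.Strategy A E,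
      (∀ i, (π i).IsOracleComputable O) ∧
      ∀ i, ReflOracle.IsOptimal r γ (ReflOracle.subjectiveEnv σ π i) (π i) := by
  obtain ⟨ev, hev, h⟩ := ReflOracle.exists_comparison hr hrc hγ hγs hΓ hσ
  obtain ⟨π, hc, hπ⟩ := ReflOracle.exists_greedy_strategies hO
    (fun π i h => ReflOracle.actionValue r γ (ReflOracle.subjectiveEnv σ π i) (π i) h) hev
    (fun π i h' a b => (h π i h' a b).1) (fun π i h' a b => (h π i h' a b).2)
  exact ⟨π, hc, fun i => ReflOracle.isOptimal_of_greedy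
    (ReflOracle.isContextual_subjectiveEnv σ π i) hγ hγs hr (hπ i)⟩
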